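/- Let $a_1,\dots,a_4,b_1,\dots,b_4\in\mathbb{R}$ and consider the ordinary differential equation on $\mathbb{R}^2$ $$\dot u = e^{a_1u+b_1v}-e^{a_2u+b_2v},\qquad \dot v = e^{a_3u+b_3v}-e^{a_4u+b_4v},$$ whose Jacobian matrix at the equilibrium $(0,0)$ is $$J=\begin{pmatrix} a_1-a_2 & b_1-b_2\\ a_3-a_4 & b_3-b_4\end{pmatrix}.$$ The equation is called permanent if there is a compact set $K\subset\mathbb{R}^2$ that is forward invariant and a global attractor, i.e. the forward solution through every point of $\mathbb{R}^2$ exists for all $t\ge 0$ and converges to $K$ as $t\to\infty$. Assume that $\det J>0$ and that one of the following holds: (A) $J_{12}<0<J_{21}$, $\;a_4\le\min(a_1,a_2)\le\max(a_1,a_2)\le a_3$ and $b_1\le\min(b_3,b_4)\le\max(b_3,b_4)\le b_2$; (B) $J_{21}<0<J_{12}$, $\;a_3\le\min(a_1,a_2)\le\max(a_1,a_2)\le a_4$ and $b_2\le\min(b_3,b_4)\le\max(b_3,b_4)\le b_1$. In case (A) let $$L_\infty=(a_3-a_1)(b_2-b_3)(a_2-a_4)(b_4-b_1)-(b_1-b_3)(a_2-a_3)(b_4-b_2)(a_4-a_1),$$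 and in case (B) let $$L_\infty=(b_1-b_3)(a_2-a_3)(b_4-b_2)(a_4-a_1)-(a_3-a_1)(b_2-b_3)(a_2-a_4)(b_4-b_1).$$ Then: (i) If $L_\infty>0$, the equation is permanent. (ii) If $L_\infty<0$, the equation is not permanent; moreover, orbits with large initial conditions spiral out to infinity: there is $R$ such that for every $x_0\in\mathbb{R}^2$ with $\|x_0\|\ge R$ the maximal forward solution $x:[0,T)\to\mathbb{R}^2$ ($0<T\le\infty$) with $x(0)=x_0$ can be written as $x(t)=r(t)(\cos\theta(t),\sin\theta(t))$ with $r>0$ and $\theta$ continuous, where $r(t)\to\infty$ and either $\theta(t)\to+\infty$ or $\theta(t)\to-\infty$ as $t\to T$. -/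

import Mathlib

open Set Filter Topology

noncomputable section

namespace PlanarSSystem

/-- The eight real exponents of a planar S-system in exponential form. -/
structure Params where
  (a₁ a₂ a₃ a₄ b₁ b₂ b₃ b₄ : ℝ)

/-- The right-hand side of
`u' = exp (a₁ u + b₁ v) - exp (a₂ u + b₂ v)`, `v' = exp (a₃ u + b₃ v) - exp (a₄ u + b₄ v)`
on the plane. -/
def field (p : Params) (x : ℝ × ℝ) : ℝ × ℝ :=
  (Real.exp (p.a₁ * x.1 + p.b₁ * x.2) - Real.exp (p.a₂ * x.1 + p.b₂ * x.2),
   Real.exp (p.a₃ * x.1 + p.b₃ * x.2) - Real.exp (p.a₄ * x.1 + p.b₄ * x.2))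

/-- The Jacobian matrix of the vector field at the origin (an equilibrium). -/
def jacobian (p : Params) : Matrix (Fin 2) (Fin 2) ℝ :=
  !![p.a₁ - p.a₂, p.b₁ - p.b₂;
     p.a₃ - p.a₄, p.b₃ - p.b₄]

/-- The time interval `[0, T)`, where `T` may be `⊤` (that is, `∞`). -/
def timeInterval (T : EReal) : Set ℝ := {t | 0 ≤ t ∧ (t : EReal) < T}

/-- The filter of times `t` tending to `T` from below; it is `atTop` when `T = ⊤`. -/
def endOfTime (T : EReal) : Filter ℝ := comap (fun t : ℝ => (t : EReal)) (𝓝[<] T)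

/-- `γ`, restricted to `[0, T)`, is a solution of `x' = F x` with initial value `x₀`. -/
def IsSolution (F : ℝ × ℝ → ℝ × ℝ) (x₀ : ℝ × ℝ) (γ : ℝ → ℝ × ℝ) (T : EReal) : Prop :=
  0 < T ∧ γ 0 = x₀ ∧ IsIntegralCurveOn γ (fun _ => F) (timeInterval T)

/-- `γ` on `[0, T)` is the forward solution through `x₀` whose interval of existence is
maximal. -/
def IsMaximalSolution (F : ℝ × ℝ → ℝ × ℝ) (x₀ : ℝ × ℝ) (γ : ℝ → ℝ × ℝ) (T : EReal) : Prop :=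
  IsSolution F x₀ γ T ∧ ∀ γ' T', IsSolution F x₀ γ' T' → T' ≤ T

/-- Every forward solution that starts in `K` stays in `K`. -/
def ForwardInvariant (F : ℝ × ℝ → ℝ × ℝ) (K : Set (ℝ × ℝ)) : Prop :=
  ∀ x₀ ∈ K, ∀ γ T, IsSolution F x₀ γ T → ∀ t ∈ timeInterval T, γ t ∈ K

/-- Through every point of the plane there is a forward solution that exists for all times
and converges to `K`, i.e. eventually lies in each neighbourhood of `K`. (This forces `K` to be
nonempty.) -/
def GloballyAttracting (F : ℝ × ℝ → ℝ × ℝ) (K : Set (ℝ × ℝ)) : Prop :=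
  ∀ x₀, ∃ γ, IsSolution F x₀ γ ⊤ ∧ Tendsto γ atTop (𝓝ˢ K)

/-- Permanence: there is a compact forward invariant set that is a global attractor. -/
def Permanent (F : ℝ × ℝ → ℝ × ℝ) : Prop :=
  ∃ K, IsCompact K ∧ ForwardInvariant F K ∧ GloballyAttracting F K

/-- The curve `γ` on `[0, T)` spirals out to infinity: in polar coordinates about the origin,
with continuous angle `θ`, its radius tends to infinity and it winds infinitely often around
the origin in one of the two directions. -/
def SpiralsToInfinity (γ : ℝ → ℝ × ℝ) (T : EReal) : Prop :=
  ∃ r θ : ℝ → ℝ,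
    ContinuousOn θ (timeInterval T) ∧
    (∀ t ∈ timeInterval T,
      0 < r t ∧ γ t = (r t * Real.cos (θ t), r t * Real.sin (θ t))) ∧
    Tendsto r (endOfTime T) atTop ∧
    (Tendsto θ (endOfTime T) atTop ∨ Tendsto θ (endOfTime T) atBot)

/-- All orbits with large initial conditions spiral out to infinity, as time tends to the end of
the maximal interval of existence (solutions may blow up in finite time). -/
def LargeOrbitsSpiralToInfinity (F : ℝ × ℝ → ℝ × ℝ) : Prop :=
  ∃ R : ℝ, ∀ x₀ : ℝ × ℝ, R ≤ ‖x₀‖ →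
    ∃ γ T, IsMaximalSolution F x₀ γ T ∧ SpiralsToInfinity γ T

/-- Configuration (A). -/
def ConfigA (p : Params) : Prop :=
  jacobian p 0 1 < 0 ∧ 0 < jacobian p 1 0 ∧
  p.a₄ ≤ min p.a₁ p.a₂ ∧ max p.a₁ p.a₂ ≤ p.a₃ ∧
  p.b₁ ≤ min p.b₃ p.b₄ ∧ max p.b₃ p.b₄ ≤ p.b₂

/-- Configuration (B). -/
def ConfigB (p : Params) : Prop :=
  0 < jacobian p 0 1 ∧ jacobian p 1 0 < 0 ∧
  p.a₃ ≤ min p.a₁ p.a₂ ∧ max p.a₁ p.a₂ ≤ p.a₄ ∧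
  p.b₂ ≤ min p.b₃ p.b₄ ∧ max p.b₃ p.b₄ ≤ p.b₁

/-- The quantity `L_∞` in configuration (A). -/
def LinftyA (p : Params) : ℝ :=
  (p.a₃ - p.a₁) * (p.b₂ - p.b₃) * (p.a₂ - p.a₄) * (p.b₄ - p.b₁)
    - (p.b₁ - p.b₃) * (p.a₂ - p.a₃) * (p.b₄ - p.b₂) * (p.a₄ - p.a₁)

/-- The quantity `L_∞` in configuration (B). -/
def LinftyB (p : Params) : ℝ :=
  (p.b₁ - p.b₃) * (p.a₂ - p.a₃) * (p.b₄ - p.b₂) * (p.a₄ - p.a₁)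
    - (p.a₃ - p.a₁) * (p.b₂ - p.b₃) * (p.a₂ - p.a₄) * (p.b₄ - p.b₁)

end PlanarSSystem

end

/-! Write `e₁, …, e₄` for the four exponentials of the field. In configuration (A) the flow far out
circulates counterclockwise. Take a rectangle `[-X', X] × [-Y', Y]` turned clockwise by a small
angle, so that the circulating flow enters it. On the right side, `u - ε v` has derivative `e₁ - e₂
- ε e₃ + ε e₄`. The term `ε e₄` is controlled by `e₂` or `e₁`, so it suffices that `ε e₃` beats
`e₁`. For small `ε` and far out this is decided at the lower corner `(X, -Y')`: it holds if `(b₃ -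
b₁) Y' < (a₃ - a₁) X`. Quarter turns give one such condition per corner, and the cyclic system of
four is solvable because `L_∞ > 0` compares the products of its coefficients (`exists_rectangle`).
The gauge of the rectangle is then a Lyapunov function near infinity (`hasLyapunov_of_configA`),
whence permanence (`HasLyapunov.permanent`). Interchanging `u` and `v` reduces (B) to (A).

Time reversal exchanges (A) and (B) and negates `L_∞`. Hence for `L_∞ < 0` the reversed flow has
such a gauge, and orbits starting far out leave every bounded set (`HasLyapunov.escape_of_neg`).
They also wind (`Expanding.winding`): the half-axes are crossed in one direction only, and no orbit
escapes inside a single quadrant (`Expanding.exists_not_mem_quadrant`). -/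

namespace PlanarSSystem

/-! ### Time intervals -/

lemma zero_mem_timeInterval {T : EReal} (hT : 0 < T) : (0 : ℝ) ∈ timeInterval T :=
  ⟨le_rfl, by simpa using hT⟩

lemma mem_timeInterval_of_le {T : EReal} {s t : ℝ} (ht : t ∈ timeInterval T) (h0 : 0 ≤ s)
    (hst : s ≤ t) : s ∈ timeInterval T :=
  ⟨h0, lt_of_le_of_lt (EReal.coe_le_coe_iff.2 hst) ht.2⟩

lemma Icc_subset_timeInterval {T : EReal} {t : ℝ} (ht : t ∈ timeInterval T) :
    Icc 0 t ⊆ timeInterval T :=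
  fun _ hs => mem_timeInterval_of_le ht hs.1 hs.2

lemma timeInterval_coe (T : ℝ) : timeInterval (T : EReal) = Ico 0 T := by
  ext t; simp [timeInterval]

lemma mem_timeInterval_top {t : ℝ} : t ∈ timeInterval ⊤ ↔ 0 ≤ t := by
  simp [timeInterval, EReal.coe_lt_top]

lemma exists_gt_mem_timeInterval {T : EReal} {t : ℝ} (ht : t ∈ timeInterval T) :
    ∃ t' ∈ timeInterval T, t < t' := by
  obtain ⟨c, h1, h2⟩ := EReal.lt_iff_exists_real_btwn.1 ht.2
  have h1' : t < c := EReal.coe_lt_coe_iff.1 h1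
  exact ⟨c, ⟨ht.1.trans h1'.le, h2⟩, h1'⟩

lemma timeInterval_mem_nhdsGE {T : EReal} {t : ℝ} (ht : t ∈ timeInterval T) :
    timeInterval T ∈ 𝓝[≥] t := by
  obtain ⟨t', ht', h⟩ := exists_gt_mem_timeInterval ht
  filter_upwards [Icc_mem_nhdsGE h] with s hs
  exact mem_timeInterval_of_le ht' (ht.1.trans hs.1) hs.2

lemma eventually_endOfTime {T : EReal} {P : ℝ → Prop} {t₀ : ℝ} (ht₀ : t₀ ∈ timeInterval T)
    (h : ∀ t ∈ timeInterval T, t₀ ≤ t → P t) : ∀ᶠ t in endOfTime T, P t := by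
  refine mem_comap.2 ⟨Ioo (t₀ : EReal) T, Ioo_mem_nhdsLT ht₀.2, fun t ht => ?_⟩
  have h1 : t₀ ≤ t := (EReal.coe_lt_coe_iff.1 ht.1).le
  exact h t ⟨ht₀.1.trans h1, ht.2⟩ h1

lemma tendsto_endOfTime_atTop {T : EReal} {f : ℝ → ℝ}
    (h : ∀ M, ∃ t₀ ∈ timeInterval T, ∀ t ∈ timeInterval T, t₀ ≤ t → M ≤ f t) :
    Tendsto f (endOfTime T) atTop := by
  refine tendsto_atTop.2 fun M => ?_
  obtain ⟨t₀, ht₀, h'⟩ := h M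
  exact eventually_endOfTime ht₀ h'

/-! ### Solutions of planar autonomous equations -/

variable {F : ℝ × ℝ → ℝ × ℝ} {x₀ : ℝ × ℝ} {γ γ₁ γ₂ : ℝ → ℝ × ℝ} {T T₁ T₂ : EReal}

lemma hasDerivWithinAt_Ici
    (h : IsIntegralCurveOn γ (fun _ => F) (timeInterval T)) {t : ℝ} (ht : t ∈ timeInterval T) :
    HasDerivWithinAt γ (F (γ t)) (Ici t) t :=
  (h t ht).mono_of_mem_nhdsWithin (timeInterval_mem_nhdsGE ht)

lemma IsSolution.eqOn (hF : ContDiff ℝ 1 F) (h₁ : IsSolution F x₀ γ₁ T₁)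
    (h₂ : IsSolution F x₀ γ₂ T₂) {t : ℝ} (ht₁ : t ∈ timeInterval T₁) (ht₂ : t ∈ timeInterval T₂) :
    γ₁ t = γ₂ t := by
  have s₁ := Icc_subset_timeInterval ht₁
  have s₂ := Icc_subset_timeInterval ht₂
  have c₁ : ContinuousOn γ₁ (Icc 0 t) := h₁.2.2.continuousOn.mono s₁
  have c₂ : ContinuousOn γ₂ (Icc 0 t) := h₂.2.2.continuousOn.mono s₂
  obtain ⟨K, hK⟩ := (hF.locallyLipschitz.locallyLipschitzOn
    (s := γ₁ '' Icc 0 t ∪ γ₂ '' Icc 0 t)).exists_lipschitzOnWith_of_compact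
    ((isCompact_Icc.image_of_continuousOn c₁).union (isCompact_Icc.image_of_continuousOn c₂))
  exact ODE_solution_unique_of_mem_Icc_right (v := fun _ => F) (fun _ _ => hK) c₁
    (fun s hs => hasDerivWithinAt_Ici h₁.2.2 (s₁ (Ico_subset_Icc_self hs)))
    (fun s hs => Or.inl (mem_image_of_mem _ (Ico_subset_Icc_self hs))) c₂
    (fun s hs => hasDerivWithinAt_Ici h₂.2.2 (s₂ (Ico_subset_Icc_self hs)))
    (fun s hs => Or.inr (mem_image_of_mem _ (Ico_subset_Icc_self hs)))
    (h₁.2.1.trans h₂.2.1.symm) ⟨ht₁.1, le_rfl⟩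

lemma exists_isSolution (hF : ContDiff ℝ 1 F) (x₀ : ℝ × ℝ) : ∃ γ T, IsSolution F x₀ γ T := by
  obtain ⟨α, h0, ε, hε, h⟩ :=
    hF.contDiffAt.exists_forall_mem_closedBall_exists_eq_forall_mem_Ioo_hasDerivAt₀
      (x₀ := x₀) 0
  refine ⟨α, (ε : ℝ), by exact_mod_cast hε, h0, fun t ht => (h t ?_).hasDerivWithinAt⟩
  rw [timeInterval_coe] at ht
  constructor <;> linarith [ht.1, ht.2]

/-- Every initial value problem with a `C¹` vector field has a maximal forward solution. -/
lemma exists_isMaximalSolution (hF : ContDiff ℝ 1 F) (x₀ : ℝ × ℝ) :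
    ∃ γ T, IsMaximalSolution F x₀ γ T := by
  classical
  set S : Set EReal := {T | ∃ γ, IsSolution F x₀ γ T} with hS
  have key : ∀ t : ℝ, (t : EReal) < sSup S → ∃ γ T, IsSolution F x₀ γ T ∧ (t : EReal) < T := by
    intro t ht
    obtain ⟨T, ⟨γ, hγ⟩, hT⟩ := lt_sSup_iff.1 ht
    exact ⟨γ, T, hγ, hT⟩
  choose! c τ hc hτ using key
  obtain ⟨γ₀, T₀, h₀⟩ := exists_isSolution hF x₀
  have hpos : 0 < sSup S := h₀.1.trans_le (le_sSup ⟨γ₀, h₀⟩)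
  have hagree : ∀ t ∈ timeInterval (sSup S), ∀ γ T, IsSolution F x₀ γ T → t ∈ timeInterval T →
      c t t = γ t := fun t ht γ T h hT => (hc t ht.2).eqOn hF h ⟨ht.1, hτ t ht.2⟩ hT
  -- The value at `t` is read off from any solution still alive at `t`; by uniqueness the choice is
  -- immaterial, so near `t` the diagonal agrees with the single solution `c t'`, `t' > t`.
  refine ⟨fun t => c t t, sSup S, ⟨hpos, ?_, ?_⟩, fun γ' T' h' => le_sSup ⟨γ', h'⟩⟩
  · exact (hc 0 (by simpa using hpos)).2.1
  · intro t ht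
    obtain ⟨t', ht', htt'⟩ := exists_gt_mem_timeInterval ht
    have hsol := hc t' ht'.2
    have hlt := hτ t' ht'.2
    have hmem : t ∈ timeInterval (τ t') := ⟨ht.1, (EReal.coe_lt_coe_iff.2 htt').trans hlt⟩
    have hd := hsol.2.2 t hmem
    have hsub : timeInterval (sSup S) ∩ Iio t' ⊆ timeInterval (τ t') := fun s hs =>
      ⟨hs.1.1, (EReal.coe_lt_coe_iff.2 hs.2).trans hlt⟩
    have hd' : HasDerivWithinAt (c t') (F (c t' t)) (timeInterval (sSup S)) t :=
      (hd.mono hsub).mono_of_mem_nhdsWithin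
        (inter_mem self_mem_nhdsWithin (mem_nhdsWithin_of_mem_nhds (Iio_mem_nhds htt')))
    have heq := hagree t ht _ _ hsol hmem
    simp only [heq]
    refine hd'.congr_of_eventuallyEq ?_ heq
    filter_upwards [self_mem_nhdsWithin, mem_nhdsWithin_of_mem_nhds (Iio_mem_nhds htt')]
      with s hs hs'
    exact hagree s hs _ _ hsol (hsub ⟨hs, hs'⟩)

/-- Used to contradict maximality: `γ` is replaced by `α` from `τ` on, which yields a solution up to
`τ + ε`, possibly beyond `T`. -/
lemma IsSolution.glue {τ ε : ℝ} {α : ℝ → ℝ × ℝ} (h : IsSolution F x₀ γ T)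
    (hτ : τ ∈ timeInterval T) (hε : 0 < ε) (hα : α τ = γ τ)
    (hα' : ∀ t ∈ Ioo (τ - ε) (τ + ε), HasDerivAt α (F (α t)) t) :
    ∃ γ', IsSolution F x₀ γ' ((τ + ε : ℝ) : EReal) := by
  classical
  set g : ℝ → ℝ × ℝ := fun t => if t ≤ τ then γ t else α t with hg
  have g1 : ∀ t ≤ τ, g t = γ t := fun t ht => if_pos ht
  have g2 : ∀ t, τ ≤ t → g t = α t := fun t ht => by
    rcases ht.eq_or_lt with rfl | ht
    · rw [g1 _ le_rfl, hα]
    · exact if_neg ht.not_ge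
  refine ⟨g, by exact_mod_cast (by linarith [hτ.1] : 0 < τ + ε), ?_, ?_⟩
  · rw [g1 _ hτ.1, h.2.1]
  rw [timeInterval_coe]
  intro t ht
  rcases lt_trichotomy t τ with htτ | rfl | htτ
  · have hm : t ∈ timeInterval T := mem_timeInterval_of_le hτ ht.1 htτ.le
    have hd := (h.2.2 t hm).mono (Icc_subset_timeInterval hτ)
    have hd' : HasDerivWithinAt γ (F (γ t)) (Ico 0 (τ + ε)) t := by
      refine hd.mono_of_mem_nhdsWithin ?_
      filter_upwards [self_mem_nhdsWithin, mem_nhdsWithin_of_mem_nhds (Iio_mem_nhds htτ)]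
        with s hs hs'
      exact ⟨hs.1, hs'.le⟩
    rw [g1 t htτ.le]
    refine hd'.congr_of_eventuallyEq ?_ (g1 t htτ.le)
    filter_upwards [mem_nhdsWithin_of_mem_nhds (Iio_mem_nhds htτ)] with s hs
    exact g1 s (le_of_lt hs)
  · have l : HasDerivWithinAt g (F (g t)) (Icc 0 t) t := by
      rw [g1 t le_rfl]
      exact ((h.2.2 t hτ).mono (Icc_subset_timeInterval hτ)).congr (fun s hs => g1 s hs.2)
        (g1 t le_rfl)
    have r : HasDerivWithinAt g (F (g t)) (Ici t) t := by
      rw [g2 t le_rfl]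
      exact (hα' t ⟨by linarith, by linarith⟩).hasDerivWithinAt.congr (fun s hs => g2 s hs)
        (g2 t le_rfl)
    refine (l.union r).mono fun s hs => ?_
    rcases le_total s t with h' | h'
    · exact Or.inl ⟨hs.1, h'⟩
    · exact Or.inr h'
  · rw [g2 t htτ.le]
    refine ((hα' t ⟨by linarith, ht.2⟩).congr_of_eventuallyEq ?_).hasDerivWithinAt
    filter_upwards [Ioi_mem_nhds htτ] with s hs
    exact g2 s (le_of_lt hs)

/-- A maximal solution that stays in a compact set exists for all times. -/
lemma IsMaximalSolution.eq_top (hF : ContDiff ℝ 1 F) (h : IsMaximalSolution F x₀ γ T)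
    {C : Set (ℝ × ℝ)} (hC : IsCompact C) (hγ : ∀ t ∈ timeInterval T, γ t ∈ C) : T = ⊤ := by
  induction T with
  | top => rfl
  | bot => exact absurd h.1.1 (by simp)
  | coe T =>
    exfalso
    have hT : 0 < T := by exact_mod_cast h.1.1
    rw [timeInterval_coe] at hγ
    have hev : ∀ᶠ t in 𝓝[<] T, t ∈ Ico 0 T := by
      filter_upwards [Ioo_mem_nhdsLT hT] with t ht using ⟨ht.1.le, ht.2⟩
    have hle : map γ (𝓝[<] T) ≤ 𝓟 C := by
      refine le_principal_iff.2 (mem_map.2 ?_)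
      filter_upwards [hev] with t ht using hγ t ht
    obtain ⟨y, -, hy⟩ := hC hle
    -- Around the cluster point `y` the local existence time `ε` is uniform, so restarting at some
    -- `τ > T - ε` with `γ τ` close to `y` passes `T`.
    obtain ⟨r, hr, ε, hε, H⟩ := (hF.contDiffAt (x :=
      y)).exists_forall_mem_closedBall_exists_eq_forall_mem_Ioo_hasDerivAt 0
    have hfr : ∃ᶠ t in 𝓝[<] T, γ t ∈ Metric.closedBall y r :=
      (mapClusterPt_iff_frequently.1 hy) _ (Metric.closedBall_mem_nhds y hr)
    obtain ⟨τ, hτy, hτ, hτε⟩ :=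
      (hfr.and_eventually (hev.and (Ioo_mem_nhdsLT (sub_lt_self T hε)))).exists
    obtain ⟨α, hα, hα'⟩ := H _ hτy
    have hτm : τ ∈ timeInterval (T : EReal) := by rwa [timeInterval_coe]
    obtain ⟨γ', hγ'⟩ := h.1.glue (α := fun t => α (t - τ)) hτm hε (by simpa using hα)
      (fun t ht => by
        have := hα' (t - τ) ⟨by linarith [ht.1], by linarith [ht.2]⟩
        simpa using! this.comp_sub_const t τ)
    have := EReal.coe_le_coe_iff.1 (h.2 _ _ hγ')
    linarith [hτε.1]

/-! ### Polyhedral Lyapunov functions -/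

/-- The maximum of four linear functionals. -/
def maxFun (W : Fin 4 → (ℝ × ℝ →L[ℝ] ℝ)) (x : ℝ × ℝ) : ℝ :=
  Finset.univ.sup' Finset.univ_nonempty (fun i => W i x)

/-- `G` admits a polyhedral Lyapunov function outside of a bounded set: a positive definite
maximum of linear functionals, each of which decreases along `G` where it attains the maximum
and the maximum is large. -/
def HasLyapunov (G : ℝ × ℝ → ℝ × ℝ) : Prop :=
  ∃ (W : Fin 4 → (ℝ × ℝ →L[ℝ] ℝ)) (c k : ℝ), 0 < c ∧ 0 < k ∧
    (∀ x, k * ‖x‖ ≤ maxFun W x) ∧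
    ∀ x i, c ≤ maxFun W x → W i x = maxFun W x → W i (G x) < 0

variable {W : Fin 4 → (ℝ × ℝ →L[ℝ] ℝ)} {F G : ℝ × ℝ → ℝ × ℝ} {c k : ℝ}

lemma le_maxFun (W : Fin 4 → (ℝ × ℝ →L[ℝ] ℝ)) (x : ℝ × ℝ) (i : Fin 4) : W i x ≤ maxFun W x :=
  Finset.le_sup' (fun i => W i x) (Finset.mem_univ i)

lemma maxFun_lt_iff {x : ℝ × ℝ} {a : ℝ} : maxFun W x < a ↔ ∀ i, W i x < a := by
  simp [maxFun]

lemma exists_eq_maxFun (W : Fin 4 → (ℝ × ℝ →L[ℝ] ℝ)) (x : ℝ × ℝ) : ∃ i, W i x = maxFun W x := by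
  obtain ⟨i, -, hi⟩ := Finset.exists_mem_eq_sup' Finset.univ_nonempty (fun i => W i x)
  exact ⟨i, hi.symm⟩

lemma continuous_maxFun (W : Fin 4 → (ℝ × ℝ →L[ℝ] ℝ)) : Continuous (maxFun W) :=
  Continuous.finset_sup'_apply _ fun i _ => (W i).continuous

/-- The right upper derivative of a maximum is governed by the functionals attaining it; the others
stay strictly below for a short time by continuity. The barrier comparison theorem then applies. -/
lemma maxFun_le_of_barrier {η : ℝ → ℝ × ℝ} {B B' : ℝ → ℝ} {τ : ℝ}
    (hη : ∀ t ∈ Icc 0 τ, HasDerivWithinAt η (G (η t)) (Icc 0 τ) t)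
    (h0 : maxFun W (η 0) ≤ B 0) (hB : ∀ t, HasDerivAt B (B' t) t)
    (hb : ∀ t ∈ Ico 0 τ, maxFun W (η t) = B t → ∀ i, W i (η t) = maxFun W (η t) →
      W i (G (η t)) < B' t) :
    ∀ t ∈ Icc 0 τ, maxFun W (η t) ≤ B t := by
  classical
  set A : ℝ → Finset (Fin 4) := fun t => Finset.univ.filter fun i => W i (η t) = maxFun W (η t)
  have hA : ∀ t, (A t).Nonempty := fun t => by
    obtain ⟨i, hi⟩ := exists_eq_maxFun W (η t)
    exact ⟨i, by simp [A, hi]⟩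
  have hcont : ContinuousOn η (Icc 0 τ) := fun t ht => (hη t ht).continuousWithinAt
  refine image_le_of_liminf_slope_right_lt_deriv_boundary (f := fun t => maxFun W (η t))
    (f' := fun t => (A t).sup' (hA t) fun i => W i (G (η t)))
    ((continuous_maxFun W).comp_continuousOn hcont) ?_ h0 hB ?_
  · intro t ht r hr
    rw [Finset.sup'_lt_iff] at hr
    have hd : HasDerivWithinAt η (G (η t)) (Ioi t) t :=
      (hη t (Ico_subset_Icc_self ht)).mono_of_mem_nhdsWithin
        (mem_of_superset (Ioo_mem_nhdsGT ht.2) fun s hs => ⟨ht.1.trans hs.1.le, hs.2.le⟩)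
    have key : ∀ i, ∀ᶠ s in 𝓝[>] t, W i (η s) < maxFun W (η t) + (s - t) * r := by
      intro i
      by_cases hi : W i (η t) = maxFun W (η t)
      · have hi' : W i (G (η t)) < r := hr i (by simp [A, hi])
        have hWd : HasDerivWithinAt (fun s => W i (η s)) (W i (G (η t))) (Ioi t) t :=
          (W i).hasFDerivAt.comp_hasDerivWithinAt t hd
        have := (hasDerivWithinAt_iff_tendsto_slope' (by simp)).1 hWd
        filter_upwards [this.eventually (gt_mem_nhds hi'), self_mem_nhdsWithin] with s hs hst
        have hst' : 0 < s - t := sub_pos.2 hst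
        rw [slope_def_field, div_lt_iff₀ hst', hi] at hs
        linarith
      · have hlt : W i (η t) < maxFun W (η t) + (t - t) * r := by
          simpa using lt_of_le_of_ne (le_maxFun W (η t) i) hi
        have c1 : ContinuousWithinAt (fun s => W i (η s)) (Ioi t) t :=
          (W i).continuous.continuousAt.comp_continuousWithinAt hd.continuousWithinAt
        have c2 : ContinuousWithinAt (fun s => maxFun W (η t) + (s - t) * r) (Ioi t) t := by
          fun_prop
        exact c1.eventually_lt c2 hlt
    have := (eventually_all.2 key).and self_mem_nhdsWithin
    refine (this.mono fun s hs => ?_).frequently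
    have hst' : 0 < s - t := sub_pos.2 hs.2
    rw [slope_def_field, div_lt_iff₀ hst']
    have := maxFun_lt_iff.2 hs.1
    linarith
  · intro t ht hBt
    rw [Finset.sup'_lt_iff]
    intro i hi
    exact hb t ht hBt i (by simpa [A] using hi)

lemma isCompact_maxFun_le (hk : 0 < k) (hW : ∀ x, k * ‖x‖ ≤ maxFun W x) (M : ℝ) :
    IsCompact {x | maxFun W x ≤ M} := by
  refine Metric.isCompact_of_isClosed_isBounded
    (isClosed_le (continuous_maxFun W) continuous_const)
    ((Metric.isBounded_closedBall (x := (0 : ℝ × ℝ)) (r := M / k)).subset fun x hx => ?_)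
  rw [mem_closedBall_zero_iff, le_div_iff₀' hk]
  exact (hW x).trans hx

/-- Compactness of the shell `c ≤ maxFun W ≤ M` makes the strict decrease uniform. -/
lemma exists_decay_rate (hG : Continuous G) (hk : 0 < k) (hW : ∀ x, k * ‖x‖ ≤ maxFun W x)
    (hdec : ∀ x i, c ≤ maxFun W x → W i x = maxFun W x → W i (G x) < 0) (M : ℝ) :
    ∃ m > 0, ∀ x i, c ≤ maxFun W x → maxFun W x ≤ M → W i x = maxFun W x → W i (G x) ≤ -m := by
  have key : ∀ i, ∃ m > 0, ∀ x ∈ {x | maxFun W x ≤ M} ∩ {x | c ≤ maxFun W x ∧ W i x = maxFun W x},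
      m ≤ -W i (G x) := fun i => by
    refine ((isCompact_maxFun_le hk hW M).inter_right ?_).exists_forall_le' (a := (0 : ℝ))
      (f := fun x => -W i (G x)) ?_ ?_
    · exact (isClosed_le continuous_const (continuous_maxFun W)).inter
        (isClosed_eq (W i).continuous (continuous_maxFun W))
    · exact ((W i).continuous.comp hG).neg.continuousOn
    · intro x hx
      have := hdec x i hx.2.1 hx.2.2
      linarith
  choose m hm hm' using key
  obtain ⟨j, -, hj⟩ := Finset.exists_min_image Finset.univ m Finset.univ_nonempty
  refine ⟨m j, hm j, fun x i h1 h2 h3 => ?_⟩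
  have := hm' i x ⟨h2, h1, h3⟩
  linarith [hj i (Finset.mem_univ i)]

lemma maxFun_le_of_le {η : ℝ → ℝ × ℝ} {τ C : ℝ}
    (hη : ∀ t ∈ Icc 0 τ, HasDerivWithinAt η (G (η t)) (Icc 0 τ) t)
    (hdec : ∀ x i, c ≤ maxFun W x → W i x = maxFun W x → W i (G x) < 0)
    (hC : c ≤ C) (h0 : maxFun W (η 0) ≤ C) : ∀ t ∈ Icc 0 τ, maxFun W (η t) ≤ C :=
  maxFun_le_of_barrier hη (B := fun _ => C) (B' := fun _ => 0) h0 (fun _ => hasDerivAt_const _ _)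
    fun _ _ h i hi => hdec _ i (h ▸ hC) hi

lemma maxFun_le_sub {η : ℝ → ℝ × ℝ} {τ m M : ℝ}
    (hη : ∀ t ∈ Icc 0 τ, HasDerivWithinAt η (G (η t)) (Icc 0 τ) t) (hm : 0 < m)
    (hrate : ∀ x i, c ≤ maxFun W x → maxFun W x ≤ M → W i x = maxFun W x → W i (G x) ≤ -m)
    (h0 : maxFun W (η 0) ≤ M) (hge : ∀ t ∈ Icc 0 τ, c ≤ maxFun W (η t)) :
    ∀ t ∈ Icc 0 τ, maxFun W (η t) ≤ maxFun W (η 0) - m / 2 * t := by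
  -- Half the rate leaves the strict inequality required at contact with the barrier.
  refine maxFun_le_of_barrier hη (B := fun t => maxFun W (η 0) - m / 2 * t) (B' := fun _ => -(m / 2))
    (by simp) (fun t => ?_) fun t ht h i hi => ?_
  · simpa using ((hasDerivAt_id t).const_mul (m / 2)).const_sub (maxFun W (η 0))
  · have h1 : maxFun W (η t) ≤ M := by
      have : 0 ≤ m / 2 * t := mul_nonneg (by linarith) ht.1
      linarith
    have := hrate _ i (hge t (Ico_subset_Icc_self ht)) h1 hi
    linarith

/-- A vector field with a polyhedral Lyapunov function is permanent. -/
theorem HasLyapunov.permanent (hF : ContDiff ℝ 1 F) (h : HasLyapunov F) : Permanent F := by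
  obtain ⟨W, c, k, hc, hk, hW, hdec⟩ := h
  have inv : ∀ x₀ γ T, IsSolution F x₀ γ T → ∀ C, c ≤ C → ∀ s ∈ timeInterval T,
      maxFun W (γ s) ≤ C → ∀ t ∈ timeInterval T, s ≤ t → maxFun W (γ t) ≤ C := by
    intro x₀ γ T hγ C hC s hs hsC t ht hst
    have hη : ∀ r ∈ Icc 0 (t - s), HasDerivWithinAt (fun r => γ (r + s)) (F (γ (r + s)))
        (Icc 0 (t - s)) r := by
      intro r hr
      have h1 : HasDerivWithinAt γ (F (γ (r + s))) (timeInterval T) (r + s) := hγ.2.2 _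
        (mem_timeInterval_of_le ht (by linarith [hr.1, hs.1]) (by linarith [hr.2]))
      have h2 : HasDerivWithinAt (fun r : ℝ => r + s) 1 (Icc 0 (t - s)) r :=
        (hasDerivWithinAt_id r _).add_const s
      simpa using! h1.scomp r h2 fun r hr => mem_timeInterval_of_le ht
        (by linarith [hr.1, hs.1]) (by linarith [hr.2])
    have := maxFun_le_of_le hη hdec hC (by simpa using hsC) (t - s) ⟨by linarith, le_rfl⟩
    simpa using this
  refine ⟨{x | maxFun W x ≤ c}, isCompact_maxFun_le hk hW c, ?_, fun x₀ => ?_⟩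
  · intro x₀ hx₀ γ T hγ t ht
    refine inv x₀ γ T hγ c le_rfl 0 (zero_mem_timeInterval hγ.1) ?_ t ht ht.1
    rw [hγ.2.1]; exact hx₀
  obtain ⟨γ, T, hγ⟩ := exists_isMaximalSolution hF x₀
  set M := max c (maxFun W x₀) with hM
  have hbd : ∀ t ∈ timeInterval T, maxFun W (γ t) ≤ M := fun t ht =>
    inv x₀ γ T hγ.1 M (le_max_left _ _) 0 (zero_mem_timeInterval hγ.1.1)
      (by rw [hγ.1.2.1]; exact le_max_right _ _) t ht ht.1
  obtain rfl : T = ⊤ := hγ.eq_top hF (isCompact_maxFun_le hk hW M) hbd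
  refine ⟨γ, hγ.1, ?_⟩
  have hex : ∃ s, 0 ≤ s ∧ maxFun W (γ s) ≤ c := by
    by_contra! hcon
    obtain ⟨m, hm, hrate⟩ := exists_decay_rate hF.continuous hk hW hdec M
    -- By this time a decrease at rate `m / 2` from at most `M` would make the maximum negative.
    set τ := 2 * M / m + 1 with hτ
    have hM0 : 0 < M := hc.trans_le (le_max_left _ _)
    have hτ0 : 0 ≤ τ := by positivity
    have hsub : Icc 0 τ ⊆ timeInterval ⊤ := fun t ht => mem_timeInterval_top.2 ht.1
    have := maxFun_le_sub (fun t ht => (hγ.1.2.2 t (hsub ht)).mono hsub) hm hrate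
      (hbd 0 (mem_timeInterval_top.2 le_rfl)) (fun t ht => (hcon t ht.1).le) τ ⟨hτ0, le_rfl⟩
    have h0 := hbd 0 (mem_timeInterval_top.2 le_rfl)
    have h1 := hcon τ hτ0
    have h2 : m / 2 * τ = M + m / 2 := by rw [hτ]; field_simp
    linarith
  obtain ⟨s, hs0, hs⟩ := hex
  refine (tendsto_principal.2 ?_).mono_right principal_le_nhdsSet
  filter_upwards [eventually_ge_atTop s] with t ht
  exact inv x₀ γ ⊤ hγ.1 c le_rfl s (mem_timeInterval_top.2 hs0) hs t
    (mem_timeInterval_top.2 (hs0.trans ht)) ht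

/-- If the time-reversed field has a polyhedral Lyapunov function, then solutions that start far
away leave every bounded set. -/
theorem HasLyapunov.escape_of_neg (hF : ContDiff ℝ 1 F) (h : HasLyapunov (fun x => -F x)) :
    ∃ R > 0, ∀ x₀, R ≤ ‖x₀‖ → ∀ γ T, IsMaximalSolution F x₀ γ T ∨ (IsSolution F x₀ γ T ∧ T = ⊤) →
      (∀ t ∈ timeInterval T, γ t ≠ 0) ∧
      ∀ M, ∃ t₀ ∈ timeInterval T, ∀ t ∈ timeInterval T, t₀ ≤ t → M ≤ ‖γ t‖ := by
  obtain ⟨W, c, k, hc, hk, hW, hdec⟩ := h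
  refine ⟨(c + 1) / k, by positivity, fun x₀ hx₀ γ T hγ => ?_⟩
  have hx₀' : c < maxFun W x₀ := by
    have := hW x₀
    rw [div_le_iff₀ hk] at hx₀
    linarith
  have hsol : IsSolution F x₀ γ T := hγ.elim (fun h => h.1) (fun h => h.1)
  have h0T := zero_mem_timeInterval hsol.1
  -- Run backwards from time `t`, the orbit solves the reversed equation, along which the maximum
  -- decreases.
  have rev : ∀ t ∈ timeInterval T, ∀ r ∈ Icc 0 t, HasDerivWithinAt (fun r => γ (t - r))
      (-F (γ (t - r))) (Icc 0 t) r := by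
    intro t ht r hr
    have h1 : HasDerivWithinAt γ (F (γ (t - r))) (timeInterval T) (t - r) := hsol.2.2 _
      (mem_timeInterval_of_le ht (by linarith [hr.2]) (by linarith [hr.1]))
    have h2 : HasDerivWithinAt (fun r : ℝ => t - r) (-1) (Icc 0 t) r :=
      (hasDerivWithinAt_id r _).const_sub t
    simpa using! h1.scomp r h2 fun r hr => mem_timeInterval_of_le ht
      (by linarith [hr.2]) (by linarith [hr.1])
  have mono' : ∀ t ∈ timeInterval T, ∀ s, 0 ≤ s → s ≤ t →
      maxFun W (γ s) ≤ max c (maxFun W (γ t)) := by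
    intro t ht s hs hst
    have := maxFun_le_of_le (rev t ht) hdec (le_max_left c (maxFun W (γ t)))
      (by simp) (t - s) ⟨by linarith, by linarith⟩
    simpa only [sub_sub_cancel] using this
  have hgt : ∀ t ∈ timeInterval T, c < maxFun W (γ t) := by
    intro t ht
    by_contra! hle
    have := mono' t ht 0 le_rfl ht.1
    rw [hsol.2.1, max_eq_left hle] at this
    linarith
  have mono : ∀ t ∈ timeInterval T, ∀ s, 0 ≤ s → s ≤ t → maxFun W (γ s) ≤ maxFun W (γ t) := by
    intro t ht s hs hst
    have := mono' t ht s hs hst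
    rwa [max_eq_right (hgt t ht).le] at this
  -- On a bounded orbit the solution is global; running back for time `2 * M / m` would bring the
  -- maximum at time `0` down to at most `0`, yet it exceeds `c`.
  have unbdd : ∀ M, ∃ t ∈ timeInterval T, M < maxFun W (γ t) := by
    intro M
    by_contra! hle
    obtain rfl : T = ⊤ := by
      rcases hγ with hγ | hγ
      · exact hγ.eq_top hF (isCompact_maxFun_le hk hW M) hle
      · exact hγ.2
    obtain ⟨m, hm, hrate⟩ := exists_decay_rate hF.continuous.neg hk hW hdec M
    have hM0 : 0 < M := hc.trans ((hgt 0 h0T).trans_le (hle 0 h0T))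
    set τ := 2 * M / m with hτ
    have hτ0 : 0 ≤ τ := by positivity
    have hτm : τ ∈ timeInterval ⊤ := mem_timeInterval_top.2 hτ0
    have := maxFun_le_sub (rev τ hτm) hm hrate (by simpa using hle τ hτm)
      (fun t ht => (hgt _ (mem_timeInterval_top.2 (by linarith [ht.2]))).le) τ ⟨hτ0, le_rfl⟩
    simp only [sub_self, sub_zero] at this
    have h1 := hgt 0 h0T
    have h2 : m / 2 * τ = M := by rw [hτ]; field_simp
    linarith [hle τ hτm]
  constructor
  · intro t ht h0
    have := hgt t ht
    rw [h0] at this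
    have h00 : maxFun W 0 = 0 := by
      obtain ⟨i, hi⟩ := exists_eq_maxFun W 0
      rw [← hi, map_zero]
    linarith
  · intro M
    set K := ∑ i, ‖W i‖ + 1 with hK
    have hK0 : 0 < K := by positivity
    have hKW : ∀ x, maxFun W x ≤ K * ‖x‖ := fun x => by
      obtain ⟨i, hi⟩ := exists_eq_maxFun W x
      rw [← hi]
      refine (le_abs_self _).trans (((W i).le_opNorm x).trans ?_)
      gcongr
      have := Finset.single_le_sum (f := fun i => ‖W i‖) (fun i _ => norm_nonneg _)
        (Finset.mem_univ i)
      linarith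
    obtain ⟨t₀, ht₀, h⟩ := unbdd (K * M)
    refine ⟨t₀, ht₀, fun t ht htt => ?_⟩
    have := mono t ht t₀ ht₀.1 htt
    exact le_of_mul_le_mul_left (by linarith [hKW (γ t)]) hK0

theorem HasLyapunov.not_permanent_of_neg (hF : ContDiff ℝ 1 F)
    (h : HasLyapunov (fun x => -F x)) : ¬ Permanent F := by
  rintro ⟨K, hK, -, hattr⟩
  obtain ⟨R, hR, hesc⟩ := h.escape_of_neg hF
  obtain ⟨γ, hγ, hlim⟩ := hattr (R, 0)
  obtain ⟨-, hinf⟩ := hesc (R, 0) (by simp [abs_of_pos hR]) γ ⊤ (Or.inr ⟨hγ, rfl⟩)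
  obtain ⟨M, hM⟩ := hK.isBounded.exists_norm_le
  obtain ⟨t₀, ht₀, hlarge⟩ := hinf (M + 1)
  have hU : Metric.ball (0 : ℝ × ℝ) (M + 1) ∈ 𝓝ˢ K :=
    Metric.isOpen_ball.mem_nhdsSet.2 fun x hx => by
      rw [mem_ball_zero_iff]; linarith [hM x hx]
  obtain ⟨t, ht, htt⟩ := ((hlim.eventually hU).and (eventually_ge_atTop t₀)).exists
  replace ht : ‖γ t‖ < M + 1 := by simpa using ht
  linarith [hlarge t (mem_timeInterval_top.2 (ht₀.1.trans htt)) htt]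

/-- A linear involution that conjugates two vector fields transports Lyapunov functions. -/
lemma HasLyapunov.conj {G' : ℝ × ℝ → ℝ × ℝ} (h : HasLyapunov G) (e : ℝ × ℝ →L[ℝ] ℝ × ℝ)
    (he : ∀ x, ‖e x‖ = ‖x‖) (hG : ∀ x, e (G' x) = G (e x)) : HasLyapunov G' := by
  obtain ⟨W, c, k, hc, hk, hW, hdec⟩ := h
  refine ⟨fun i => (W i).comp e, c, k, hc, hk, fun x => ?_, fun x i h1 h2 => ?_⟩
  · rw [← he]; exact hW (e x)
  · have := hdec (e x) i h1 h2
    rwa [← hG] at this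

/-! ### Symmetries -/

/-- The parameters of the time-reversed equation. -/
def Params.rev (p : Params) : Params := ⟨p.a₂, p.a₁, p.a₄, p.a₃, p.b₂, p.b₁, p.b₄, p.b₃⟩

/-- The parameters of the equation with `u` and `v` interchanged. -/
def Params.swap (p : Params) : Params := ⟨p.b₃, p.b₄, p.b₁, p.b₂, p.a₃, p.a₄, p.a₁, p.a₂⟩

/-- The parameters of the equation in the coordinates `(v, -u)`. -/
def Params.rot (p : Params) : Params := ⟨p.b₃, p.b₄, p.b₂, p.b₁, -p.a₃, -p.a₄, -p.a₂, -p.a₁⟩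

lemma field_rev (p : Params) (x : ℝ × ℝ) : field p.rev x = -field p x := by
  ext <;> simp [field, Params.rev]

lemma field_swap (p : Params) (x : ℝ × ℝ) : field p.swap x.swap = (field p x).swap := by
  ext <;> simp [field, Params.swap, add_comm]

lemma field_rot (p : Params) (x : ℝ × ℝ) :
    field p.rot (x.2, -x.1) = ((field p x).2, -(field p x).1) := by
  ext <;> simp [field, Params.rot, add_comm]

lemma contDiff_field (p : Params) : ContDiff ℝ 1 (field p) := by
  unfold field
  fun_prop

/-! ### The Lyapunov function -/

/-- The derivative along the flow of the slightly tilted linear functional `u - ε v` is negative far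
away in a sector around the positive half-axis. -/
lemma eventually_side_decreasing (p : Params) (h₄₁ : p.a₄ ≤ p.a₁)
    (h₄₂ : p.a₄ ≤ p.a₂) (k₄₂ : p.b₄ ≤ p.b₂) (k₁₃ : p.b₁ ≤ p.b₃) (k₁₄ : p.b₁ ≤ p.b₄)
    (h₁₃ : p.a₁ ≤ p.a₃)
    {X Y : ℝ} (hX : 0 < X) (hXY : (p.b₃ - p.b₁) * Y < (p.a₃ - p.a₁) * X) :
    ∀ᶠ ε in 𝓝[>] (0 : ℝ), ∃ S, ∀ x : ℝ × ℝ, S ≤ x.1 - ε * x.2 →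
      -(Y * (x.1 - ε * x.2)) ≤ X * (x.2 + ε * x.1) →
      (field p x).1 - ε * (field p x).2 < 0 := by
  set A := p.a₃ - p.a₁ with hA
  set B := p.b₃ - p.b₁ with hB
  have hA0 : 0 ≤ A := sub_nonneg.2 h₁₃
  have hB0 : 0 ≤ B := sub_nonneg.2 k₁₃
  -- In the tilted coordinates `q = u - ε v`, `w = v + ε u` one has `(1 + ε²)(A u + B v) = (A - ε B)
  -- q + (B + ε A) w`. With `X w ≥ -Y q` this bounds `X (1 + ε²)(A u + B v)` below by `δ q`; at `ε =
  -- 0` positivity of `δ` is `hXY`.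
  have e1 : ∀ᶠ ε in 𝓝[>] (0 : ℝ), 0 < (A - ε * B) * X - (B + ε * A) * Y := by
    have : ContinuousAt (fun ε : ℝ => (A - ε * B) * X - (B + ε * A) * Y) 0 := by fun_prop
    exact (this.eventually_const_lt (by simp; linarith)).filter_mono nhdsWithin_le_nhds
  have e2 : ∀ᶠ ε in 𝓝[>] (0 : ℝ), 0 < X - ε * Y := by
    have : ContinuousAt (fun ε : ℝ => X - ε * Y) 0 := by fun_prop
    exact (this.eventually_const_lt (by simpa using hX)).filter_mono nhdsWithin_le_nhds
  filter_upwards [e1, e2, Ioo_mem_nhdsGT (zero_lt_one (α := ℝ))] with ε hδ hε hε01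
  obtain ⟨hε0, hε1⟩ := hε01
  set δ := (A - ε * B) * X - (B + ε * A) * Y with hδ'
  refine ⟨max 1 (Real.log (2 / ε) * (X * (1 + ε ^ 2)) / δ), fun x hx hxt => ?_⟩
  obtain ⟨u, v⟩ := x
  simp only at hx hxt ⊢
  have hS1 := (le_max_left _ _).trans hx
  have hS2 := (le_max_right _ _).trans hx
  rw [div_le_iff₀ hδ] at hS2
  have hu : 0 < u := by
    have : 0 < X * (1 + ε ^ 2) * u := by
      have e : X * (1 + ε ^ 2) * u = X * (u - ε * v) + ε * (X * (v + ε * u)) := by ring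
      have := mul_le_mul_of_nonneg_left hxt hε0.le
      have h3 : 0 < (X - ε * Y) * (u - ε * v) := mul_pos hε (by linarith)
      nlinarith
    exact pos_of_mul_pos_right this (by positivity)
  have hlog : Real.log (2 / ε) ≤ A * u + B * v := by
    have e : X * (1 + ε ^ 2) * (A * u + B * v)
        = (A - ε * B) * X * (u - ε * v) + (B + ε * A) * (X * (v + ε * u)) := by ring
    have := mul_le_mul_of_nonneg_left hxt (show 0 ≤ B + ε * A by positivity)
    refine le_of_mul_le_mul_left (a := X * (1 + ε ^ 2)) ?_ (by positivity)
    rw [e]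
    have e2 : (u - ε * v) * δ = (A - ε * B) * X * (u - ε * v)
      - (B + ε * A) * (Y * (u - ε * v)) := by rw [hδ']; ring
    linarith
  -- The factor `ε / 2` lets `ε e₃` absorb `e₁` twice, as needed for `v ≤ 0`, where `ε e₄` is
  -- bounded by another `e₁`.
  have hl13 : Real.exp (p.a₁ * u + p.b₁ * v) ≤ ε / 2 * Real.exp (p.a₃ * u + p.b₃ * v) := by
    have e : p.a₁ * u + p.b₁ * v = (p.a₃ * u + p.b₃ * v) - (A * u + B * v) := by
      rw [hA, hB]; ring
    rw [e, Real.exp_sub, div_le_iff₀ (Real.exp_pos _)]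
    have h1 : 2 / ε ≤ Real.exp (A * u + B * v) := by
      rw [← Real.log_le_iff_le_exp (by positivity)]; exact hlog
    have h2 : 1 ≤ ε / 2 * Real.exp (A * u + B * v) := by
      have := mul_le_mul_of_nonneg_left h1 (show 0 ≤ ε / 2 by positivity)
      have e3 : ε / 2 * (2 / ε) = 1 := by field_simp
      linarith
    nlinarith [Real.exp_pos (p.a₃ * u + p.b₃ * v)]
  simp only [field]
  have p2 := Real.exp_pos (p.a₂ * u + p.b₂ * v)
  have p3 := Real.exp_pos (p.a₃ * u + p.b₃ * v)
  rcases le_total 0 v with hv | hv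
  · have h42 : Real.exp (p.a₄ * u + p.b₄ * v) ≤ Real.exp (p.a₂ * u + p.b₂ * v) := by
      gcongr
    nlinarith
  · have h41 : Real.exp (p.a₄ * u + p.b₄ * v) ≤ Real.exp (p.a₁ * u + p.b₁ * v) := by
      refine Real.exp_le_exp.2 (add_le_add (by gcongr) ?_)
      exact mul_le_mul_of_nonpos_right k₁₄ hv
    have h4 : ε * Real.exp (p.a₄ * u + p.b₄ * v) ≤ 1 * Real.exp (p.a₁ * u + p.b₁ * v) :=
      mul_le_mul hε1.le h41 (Real.exp_pos _).le zero_le_one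
    linarith

/-- Normalize `X = 1` and solve the first three inequalities successively with slack `η`, which
keeps the lengths positive even if some `αᵢ` vanish. At `η = 0` the fourth is the product
hypothesis, so it persists for small `η`. -/
lemma exists_rectangle {α₁ α₂ α₃ α₄ β₁ β₂ β₃ β₄ : ℝ} (h1 : 0 ≤ α₁) (h2 : 0 ≤ α₂) (h3 : 0 ≤ α₃)
    (k1 : 0 < β₁) (k2 : 0 < β₂) (k3 : 0 < β₃)
    (h : α₁ * α₂ * α₃ * α₄ < β₁ * β₂ * β₃ * β₄) :
    ∃ X Y X' Y' : ℝ, 0 < X ∧ 0 < Y ∧ 0 < X' ∧ 0 < Y' ∧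
      α₁ * X < β₁ * Y ∧ α₂ * Y < β₂ * X' ∧ α₃ * X' < β₃ * Y' ∧ α₄ * Y' < β₄ * X := by
  have hc : ContinuousAt (fun η : ℝ =>
      α₄ * ((α₃ * ((α₂ * ((α₁ + η) / β₁) + η) / β₂) + η) / β₃)) 0 := by fun_prop
  have h0 : α₄ * ((α₃ * ((α₂ * ((α₁ + 0) / β₁) + 0) / β₂) + 0) / β₃) < β₄ := by
    have e : α₄ * ((α₃ * ((α₂ * ((α₁ + 0) / β₁) + 0) / β₂) + 0) / β₃)
        = α₁ * α₂ * α₃ * α₄ / (β₁ * β₂ * β₃) := by simp only [add_zero]; field_simp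
    rw [e, div_lt_iff₀ (by positivity)]
    linarith
  obtain ⟨η, hη, hη0 : 0 < η⟩ := (((hc.eventually_lt_const h0).filter_mono
    nhdsWithin_le_nhds).and (self_mem_nhdsWithin (s := Ioi (0 : ℝ)))).exists
  set Y := (α₁ + η) / β₁ with hY
  set X' := (α₂ * Y + η) / β₂ with hX'
  set Y' := (α₃ * X' + η) / β₃ with hY'
  have e1 : β₁ * Y = α₁ + η := by rw [hY]; field_simp
  have e2 : β₂ * X' = α₂ * Y + η := by rw [hX']; field_simp
  have e3 : β₃ * Y' = α₃ * X' + η := by rw [hY']; field_simp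
  refine ⟨1, Y, X', Y', one_pos, by positivity, by positivity, by positivity, ?_, ?_, ?_, ?_⟩ <;>
    linarith

lemma abs_le_of_tilt {ε r q w C : ℝ} (hε0 : 0 < ε) (hε1 : ε ≤ 1)
    (e : (1 + ε ^ 2) * r = q + ε * w) (hq : |q| ≤ C) (hw : |w| ≤ C) : |r| ≤ 2 * C := by
  have h1 : (1 + ε ^ 2) * |r| ≤ |q| + ε * |w| := by
    have h0 : (1 + ε ^ 2) * |r| = |q + ε * w| := by
      rw [← e, abs_mul, abs_of_pos (show 0 < 1 + ε ^ 2 by positivity)]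
    rw [h0]
    refine (abs_add_le _ _).trans_eq ?_
    rw [abs_mul, abs_of_pos hε0]
  have h2 : ε * |w| ≤ 1 * |w| := mul_le_mul_of_nonneg_right hε1 (abs_nonneg w)
  have h3 : 0 ≤ ε ^ 2 * |r| := by positivity
  linarith

/-- A polyhedral Lyapunov function in configuration (A) with `L_∞ > 0`: the gauge of a slightly
rotated rectangle. -/
lemma hasLyapunov_of_configA {p : Params} (h : ConfigA p) (hL : 0 < LinftyA p) :
    HasLyapunov (field p) := by
  obtain ⟨-, -, h4, h3, k1, k2⟩ := h
  obtain ⟨h41, h42⟩ := le_min_iff.1 h4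
  obtain ⟨h13, h23⟩ := max_le_iff.1 h3
  obtain ⟨k13, k14⟩ := le_min_iff.1 k1
  obtain ⟨k32, k42⟩ := max_le_iff.1 k2
  have hprod : (p.a₃ - p.a₂) * (p.b₂ - p.b₄) * (p.a₁ - p.a₄) * (p.b₃ - p.b₁)
      < (p.b₂ - p.b₃) * (p.a₂ - p.a₄) * (p.b₄ - p.b₁) * (p.a₃ - p.a₁) := by
    unfold LinftyA at hL; linarith
  have i1 := sub_nonneg.2 h41
  have i2 := sub_nonneg.2 h42
  have i3 := sub_nonneg.2 h13
  have i4 := sub_nonneg.2 h23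
  have j1 := sub_nonneg.2 k13
  have j2 := sub_nonneg.2 k14
  have j3 := sub_nonneg.2 k32
  have j4 := sub_nonneg.2 k42
  have hpos : 0 < (p.b₂ - p.b₃) * (p.a₂ - p.a₄) * (p.b₄ - p.b₁) * (p.a₃ - p.a₁) :=
    lt_of_le_of_lt (by positivity) hprod
  have b1 : 0 < p.b₂ - p.b₃ := j3.lt_of_ne fun h => by simp [← h] at hpos
  have b2 : 0 < p.a₂ - p.a₄ := i2.lt_of_ne fun h => by simp [← h] at hpos
  have b3 : 0 < p.b₄ - p.b₁ := j2.lt_of_ne fun h => by simp [← h] at hpos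
  obtain ⟨X, Y, X', Y', hX, hY, hX', hY', v1, v2, v3, v4⟩ :=
    exists_rectangle i4 j4 i1 b1 b2 b3 hprod
  -- One application per side: quarter turns bring the top, left and bottom sides to the right. The
  -- critical corner is always the one where the side begins counterclockwise.
  have s0 := eventually_side_decreasing p h41 h42 k42 k13 k14 h13 hX v4
  have s1 := eventually_side_decreasing p.rot (X := Y) (Y := X) (by simpa [Params.rot])
    (by simpa [Params.rot]) (by simpa [Params.rot]) (by simpa [Params.rot]) (by simpa [Params.rot])
    (by simpa [Params.rot]) hY (by simp only [Params.rot]; linarith)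
  have s2 := eventually_side_decreasing p.rot.rot (X := X') (Y := Y) (by simpa [Params.rot])
    (by simpa [Params.rot]) (by simpa [Params.rot]) (by simpa [Params.rot]) (by simpa [Params.rot])
    (by simpa [Params.rot]) hX' (by simp only [Params.rot]; linarith)
  have s3 := eventually_side_decreasing p.rot.rot.rot (X := Y') (Y := X') (by simpa [Params.rot])
    (by simpa [Params.rot]) (by simpa [Params.rot]) (by simpa [Params.rot]) (by simpa [Params.rot])
    (by simpa [Params.rot]) hY' (by simp only [Params.rot]; linarith)
  obtain ⟨ε, ⟨S0, s0⟩, ⟨S1, s1⟩, ⟨S2, s2⟩, ⟨S3, s3⟩, hε0, hε1⟩ :=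
    (s0.and (s1.and (s2.and (s3.and (Ioo_mem_nhdsGT (zero_lt_one (α := ℝ))))))).exists
  replace s1 : ∀ x : ℝ × ℝ, S1 ≤ x.2 + ε * x.1 → X * (x.2 + ε * x.1) ≥ Y * (x.1 - ε * x.2) →
      (field p x).2 + ε * (field p x).1 < 0 := fun x h1 h2 => by
    have := s1 (x.2, -x.1) (by simp only; linarith) (by simp only; linarith)
    rw [field_rot] at this
    simp only at this; linarith
  replace s2 : ∀ x : ℝ × ℝ, S2 ≤ -(x.1 - ε * x.2) →
      Y * -(x.1 - ε * x.2) ≥ X' * (x.2 + ε * x.1) →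
      -((field p x).1 - ε * (field p x).2) < 0 := fun x h1 h2 => by
    have := s2 (-x.1, -x.2) (by simp only; linarith) (by simp only; linarith)
    rw [field_rot p.rot (x.2, -x.1), field_rot] at this
    simp only at this; linarith
  replace s3 : ∀ x : ℝ × ℝ, S3 ≤ -(x.2 + ε * x.1) →
      X' * -(x.2 + ε * x.1) ≥ Y' * -(x.1 - ε * x.2) →
      -((field p x).2 + ε * (field p x).1) < 0 := fun x h1 h2 => by
    have := s3 (-x.2, - -x.1) (by simp only; linarith) (by simp only; linarith)
    rw [field_rot p.rot.rot (-x.1, -x.2), field_rot p.rot (x.2, -x.1), field_rot] at this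
    simp only at this; linarith
  set fu : ℝ × ℝ →L[ℝ] ℝ := ContinuousLinearMap.fst ℝ ℝ ℝ with hfu
  set fv : ℝ × ℝ →L[ℝ] ℝ := ContinuousLinearMap.snd ℝ ℝ ℝ with hfv
  set W : Fin 4 → (ℝ × ℝ →L[ℝ] ℝ) := ![X⁻¹ • (fu - ε • fv), Y⁻¹ • (fv + ε • fu),
    X'⁻¹ • -(fu - ε • fv), Y'⁻¹ • -(fv + ε • fu)] with hW
  have W0 : ∀ x, W 0 x = (x.1 - ε * x.2) / X := fun x => by
    simp [hW, hfu, hfv, div_eq_inv_mul]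
  have W1 : ∀ x, W 1 x = (x.2 + ε * x.1) / Y := fun x => by
    simp [hW, hfu, hfv, div_eq_inv_mul]; ring
  have W2 : ∀ x, W 2 x = -(x.1 - ε * x.2) / X' := fun x => by
    simp [hW, hfu, hfv, div_eq_inv_mul]
  have W3 : ∀ x, W 3 x = -(x.2 + ε * x.1) / Y' := fun x => by
    simp [hW, hfu, hfv, div_eq_inv_mul]; ring
  have bnd : ∀ x, x.1 - ε * x.2 ≤ X * maxFun W x ∧ x.2 + ε * x.1 ≤ Y * maxFun W x ∧
      -(x.1 - ε * x.2) ≤ X' * maxFun W x ∧ -(x.2 + ε * x.1) ≤ Y' * maxFun W x := fun x => by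
    have m0 := le_maxFun W x 0
    have m1 := le_maxFun W x 1
    have m2 := le_maxFun W x 2
    have m3 := le_maxFun W x 3
    rw [W0, div_le_iff₀' hX] at m0
    rw [W1, div_le_iff₀' hY] at m1
    rw [W2, div_le_iff₀' hX'] at m2
    rw [W3, div_le_iff₀' hY'] at m3
    exact ⟨m0, m1, m2, m3⟩
  set D := X + Y + X' + Y' with hD
  -- Beyond this level the active tilted coordinate exceeds the threshold `Sᵢ` of its side.
  set c := 1 + |S0| / X + |S1| / Y + |S2| / X' + |S3| / Y' with hc
  refine ⟨W, c, (2 * D)⁻¹, by positivity, by positivity, fun x => ?_, fun x i hx hi => ?_⟩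
  · obtain ⟨m0, m1, m2, m3⟩ := bnd x
    set M := maxFun W x
    have hM : 0 ≤ M := by
      by_contra! hM
      have h1 := mul_neg_of_pos_of_neg hX hM
      have h2 := mul_neg_of_pos_of_neg hX' hM
      linarith
    have mX := mul_nonneg hX.le hM
    have mY := mul_nonneg hY.le hM
    have mX' := mul_nonneg hX'.le hM
    have mY' := mul_nonneg hY'.le hM
    have hDM : D * M = X * M + Y * M + X' * M + Y' * M := by rw [hD]; ring
    have a1 : |x.1 - ε * x.2| ≤ D * M := abs_le.2 ⟨by linarith, by linarith⟩
    have a2 : |x.2 + ε * x.1| ≤ D * M := abs_le.2 ⟨by linarith, by linarith⟩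
    have u1 := fun r q w : ℝ => abs_le_of_tilt (r := r) (q := q) (w := w) (C := D * M) hε0 hε1.le
    rw [inv_mul_le_iff₀ (by positivity), Prod.norm_def, mul_assoc]
    refine max_le ?_ ?_
    · exact u1 x.1 _ _ (by ring) a1 a2
    · exact u1 x.2 _ (-(x.1 - ε * x.2)) (by ring) a2 (by rwa [abs_neg])
  · obtain ⟨m0, m1, m2, m3⟩ := bnd x
    have thr : ∀ S Z : ℝ, 0 < Z → |S| / Z ≤ c → S ≤ Z * maxFun W x := fun S Z hZ hS => by
      exact (le_abs_self S).trans ((div_le_iff₀' hZ).1 (hS.trans hx))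
    have q0 : 0 ≤ |S0| / X := by positivity
    have q1 : 0 ≤ |S1| / Y := by positivity
    have q2 : 0 ≤ |S2| / X' := by positivity
    have q3 : 0 ≤ |S3| / Y' := by positivity
    fin_cases i
    · have hi : (x.1 - ε * x.2) / X = maxFun W x := (W0 x).symm.trans hi
      rw [div_eq_iff hX.ne'] at hi
      have := s0 x (by rw [hi, mul_comm]; exact thr S0 X hX (by linarith)) (by
        have := mul_le_mul_of_nonneg_left m3 hX.le
        rw [hi]; linarith)
      change W 0 _ < 0
      rw [W0]
      exact div_neg_of_neg_of_pos this hX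
    · have hi : (x.2 + ε * x.1) / Y = maxFun W x := (W1 x).symm.trans hi
      rw [div_eq_iff hY.ne'] at hi
      have := s1 x (by rw [hi, mul_comm]; exact thr S1 Y hY (by linarith)) (by
        have := mul_le_mul_of_nonneg_left m0 hY.le
        rw [hi]; linarith)
      change W 1 _ < 0
      rw [W1]
      exact div_neg_of_neg_of_pos this hY
    · have hi : -(x.1 - ε * x.2) / X' = maxFun W x := (W2 x).symm.trans hi
      rw [div_eq_iff hX'.ne'] at hi
      have := s2 x (by rw [hi, mul_comm]; exact thr S2 X' hX' (by linarith)) (by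
        have := mul_le_mul_of_nonneg_left m1 hX'.le
        rw [hi]; linarith)
      change W 2 _ < 0
      rw [W2]
      exact div_neg_of_neg_of_pos this hX'
    · have hi : -(x.2 + ε * x.1) / Y' = maxFun W x := (W3 x).symm.trans hi
      rw [div_eq_iff hY'.ne'] at hi
      have := s3 x (by rw [hi, mul_comm]; exact thr S3 Y' hY' (by linarith)) (by
        have := mul_le_mul_of_nonneg_left m2 hY'.le
        rw [hi]; linarith)
      change W 3 _ < 0
      rw [W3]
      exact div_neg_of_neg_of_pos this hY'

lemma swap_configA {p : Params} (h : ConfigB p) : ConfigA p.swap := by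
  obtain ⟨h1, h2, h3, h4, h5, h6⟩ := h
  refine ⟨?_, ?_, ?_, ?_, ?_, ?_⟩ <;> simp_all [jacobian, Params.swap]

lemma rev_configA {p : Params} (h : ConfigB p) : ConfigA p.rev := by
  obtain ⟨h1, h2, h3, h4, h5, h6⟩ := h
  refine ⟨?_, ?_, ?_, ?_, ?_, ?_⟩ <;> simp_all [jacobian, Params.rev]

lemma rev_configB {p : Params} (h : ConfigA p) : ConfigB p.rev := by
  obtain ⟨h1, h2, h3, h4, h5, h6⟩ := h
  refine ⟨?_, ?_, ?_, ?_, ?_, ?_⟩ <;> simp_all [jacobian, Params.rev]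

lemma linftyA_swap (p : Params) : LinftyA p.swap = LinftyB p := by
  simp only [LinftyA, LinftyB, Params.swap]; ring

lemma linftyA_rev (p : Params) : LinftyA p.rev = -LinftyB p := by
  simp only [LinftyA, LinftyB, Params.rev]; ring

lemma linftyB_rev (p : Params) : LinftyB p.rev = -LinftyA p := by
  simp only [LinftyA, LinftyB, Params.rev]; ring

lemma hasLyapunov_of_configB {p : Params} (h : ConfigB p) (hL : 0 < LinftyB p) :
    HasLyapunov (field p) := by
  refine (hasLyapunov_of_configA (swap_configA h) (by rwa [linftyA_swap])).conj
    ((ContinuousLinearMap.snd ℝ ℝ ℝ).prod (ContinuousLinearMap.fst ℝ ℝ ℝ)) (fun x => ?_)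
    fun x => (field_swap p x).symm
  simp [Prod.norm_def, max_comm]

/-! ### Monotonicity along a time interval -/

lemma le_of_deriv_nonpos {T : EReal} {h h' : ℝ → ℝ}
    (hd : ∀ t ∈ timeInterval T, HasDerivWithinAt h (h' t) (timeInterval T) t) {t₀ : ℝ}
    (ht₀ : t₀ ∈ timeInterval T) (hneg : ∀ t ∈ timeInterval T, t₀ ≤ t → h' t ≤ 0) :
    ∀ t ∈ timeInterval T, t₀ ≤ t → h t ≤ h t₀ := by
  intro t ht htt
  have hsub : Icc t₀ t ⊆ timeInterval T := fun s hs =>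
    mem_timeInterval_of_le ht (ht₀.1.trans hs.1) hs.2
  exact image_le_of_deriv_right_le_deriv_boundary (f := h) (f' := h') (B := fun _ => h t₀)
    (B' := fun _ => 0) (fun s hs => ((hd s (hsub hs)).continuousWithinAt).mono hsub)
    (fun s hs => (hd s (hsub (Ico_subset_Icc_self hs))).mono_of_mem_nhdsWithin
      (timeInterval_mem_nhdsGE (hsub (Ico_subset_Icc_self hs))))
    le_rfl continuousOn_const (fun _ _ => hasDerivWithinAt_const _ _ _)
    (fun s hs => hneg s (hsub (Ico_subset_Icc_self hs)) hs.1) ⟨htt, le_rfl⟩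

lemma le_of_deriv_pos_of_eq {T : EReal} {h h' : ℝ → ℝ} {c : ℝ}
    (hd : ∀ t ∈ timeInterval T, HasDerivWithinAt h (h' t) (timeInterval T) t) {t₀ : ℝ}
    (ht₀ : t₀ ∈ timeInterval T) (h0 : c ≤ h t₀)
    (hpos : ∀ t ∈ timeInterval T, h t = c → 0 < h' t) :
    ∀ t ∈ timeInterval T, t₀ ≤ t → c ≤ h t := by
  intro t ht htt
  have hsub : Icc t₀ t ⊆ timeInterval T := fun s hs =>
    mem_timeInterval_of_le ht (ht₀.1.trans hs.1) hs.2
  have := image_le_of_deriv_right_lt_deriv_boundary (f := fun s => -h s) (f' := fun s => -h' s)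
    (B := fun _ => -c) (B' := fun _ => 0)
    (fun s hs => ((hd s (hsub hs)).continuousWithinAt).neg.mono hsub)
    (fun s hs => ((hd s (hsub (Ico_subset_Icc_self hs))).mono_of_mem_nhdsWithin
      (timeInterval_mem_nhdsGE (hsub (Ico_subset_Icc_self hs)))).neg)
    (by simpa using h0) (fun _ => hasDerivAt_const _ _)
    (fun s hs he => by
      have := hpos s (hsub (Ico_subset_Icc_self hs)) (neg_injective he)
      simpa using this) (x := t) ⟨htt, le_rfl⟩
  simpa using this

/-! ### Winding -/

/-- Configuration (A) with the strict inequalities that hold if `L_∞ < 0`. -/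
structure Expanding (p : Params) : Prop where
  a₄₂ : p.a₄ ≤ p.a₂
  a₂₃ : p.a₂ < p.a₃
  a₄₁ : p.a₄ < p.a₁
  a₁₃ : p.a₁ ≤ p.a₃
  b₁₄ : p.b₁ ≤ p.b₄
  b₄₂ : p.b₄ < p.b₂
  b₁₃ : p.b₁ < p.b₃
  b₃₂ : p.b₃ ≤ p.b₂

lemma Expanding.rot {p : Params} (h : Expanding p) : Expanding p.rot := by
  obtain ⟨h1, h2, h3, h4, h5, h6, h7, h8⟩ := h
  constructor <;> simpa [Params.rot]

/-- When `L_∞ < 0`, the larger product is positive, so none of its four factors vanishes; these are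
the strict inequalities. -/
lemma expanding_of_configA {p : Params} (h : ConfigA p) (hL : LinftyA p < 0) : Expanding p := by
  obtain ⟨-, -, h4, h3, k1, k2⟩ := h
  obtain ⟨h41, h42⟩ := le_min_iff.1 h4
  obtain ⟨h13, h23⟩ := max_le_iff.1 h3
  obtain ⟨k13, k14⟩ := le_min_iff.1 k1
  obtain ⟨k32, k42⟩ := max_le_iff.1 k2
  have i1 := sub_nonneg.2 h41
  have i2 := sub_nonneg.2 h42
  have i3 := sub_nonneg.2 h13
  have i4 := sub_nonneg.2 h23
  have j1 := sub_nonneg.2 k13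
  have j2 := sub_nonneg.2 k14
  have j3 := sub_nonneg.2 k32
  have j4 := sub_nonneg.2 k42
  have hprod : (p.a₃ - p.a₁) * (p.b₂ - p.b₃) * (p.a₂ - p.a₄) * (p.b₄ - p.b₁) <
      (p.b₃ - p.b₁) * (p.a₃ - p.a₂) * (p.b₂ - p.b₄) * (p.a₁ - p.a₄) := by
    unfold LinftyA at hL; linarith
  have hpos : 0 < (p.b₃ - p.b₁) * (p.a₃ - p.a₂) * (p.b₂ - p.b₄) * (p.a₁ - p.a₄) :=
    lt_of_le_of_lt (by positivity) hprod
  refine ⟨h42, lt_of_le_of_ne h23 ?_, lt_of_le_of_ne h41 ?_, h13, k14, lt_of_le_of_ne k42 ?_,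
    lt_of_le_of_ne k13 ?_, k32⟩ <;> intro h <;> simp [h] at hpos

/-- In the closed first quadrant, an orbit of an expanding system cannot tend to infinity. -/
lemma Expanding.exists_not_mem_quadrant {p : Params} (hp : Expanding p) {T : EReal}
    {γ : ℝ → ℝ × ℝ} (hγ : IsIntegralCurveOn γ (fun _ => field p) (timeInterval T))
    (hinf : ∀ M, ∃ t₀ ∈ timeInterval T, ∀ t ∈ timeInterval T, t₀ ≤ t → M ≤ ‖γ t‖)
    {t₀ : ℝ} (ht₀ : t₀ ∈ timeInterval T) :
    ∃ t ∈ timeInterval T, t₀ ≤ t ∧ ¬ (0 ≤ (γ t).1 ∧ 0 ≤ (γ t).2) := by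
  by_contra! hq
  have du : ∀ t ∈ timeInterval T, HasDerivWithinAt (fun t => (γ t).1) (field p (γ t)).1
      (timeInterval T) t := fun t ht => (hγ t ht).fst
  have dv : ∀ t ∈ timeInterval T, HasDerivWithinAt (fun t => (γ t).2) (field p (γ t)).2
      (timeInterval T) t := fun t ht => (hγ t ht).snd
  have lin : ∀ κ : ℝ, ∀ t ∈ timeInterval T, HasDerivWithinAt (fun t => (γ t).1 - κ * (γ t).2)
      ((field p (γ t)).1 - κ * (field p (γ t)).2) (timeInterval T) t := fun κ t ht =>
    (du t ht).sub ((dv t ht).const_mul κ)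
  have late : ∀ s ∈ timeInterval T, ∀ t ∈ timeInterval T, max s t ∈ timeInterval T := by
    intro s hs t ht
    rcases le_total s t with h | h
    · rwa [max_eq_right h]
    · rwa [max_eq_left h]
  have e42 : ∀ x : ℝ × ℝ, 0 ≤ x.1 → 0 ≤ x.2 →
      Real.exp (p.a₄ * x.1 + p.b₄ * x.2) ≤ Real.exp (p.a₂ * x.1 + p.b₂ * x.2) :=
    fun x h1 h2 => Real.exp_le_exp.2 (add_le_add (mul_le_mul_of_nonneg_right hp.a₄₂ h1)
      (mul_le_mul_of_nonneg_right hp.b₄₂.le h2))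
  have e13 : ∀ x : ℝ × ℝ, 0 ≤ x.1 → 0 ≤ x.2 → Real.exp (p.a₁ * x.1 + p.b₁ * x.2) ≤
      Real.exp (-((p.b₃ - p.b₁) * x.2)) * Real.exp (p.a₃ * x.1 + p.b₃ * x.2) := by
    intro x h1 h2
    rw [← Real.exp_add]
    refine Real.exp_le_exp.2 ?_
    have := mul_le_mul_of_nonneg_right hp.a₁₃ h1
    linarith
  have hb13 : 0 < p.b₃ - p.b₁ := sub_pos.2 hp.b₁₃
  -- In the quadrant `e₁ ≤ e₃` and `e₄ ≤ e₂`, so `u - v` does not increase; an unbounded orbit must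
  -- then have `v → ∞`.
  have vinf : ∀ M, ∃ t₁ ∈ timeInterval T, t₀ ≤ t₁ ∧ ∀ t ∈ timeInterval T, t₁ ≤ t →
      M ≤ (γ t).2 := by
    have hle := le_of_deriv_nonpos (lin 1) ht₀ fun t ht htt => by
      obtain ⟨h1, h2⟩ := hq t ht htt
      have h13 := e13 _ h1 h2
      have h42 := e42 _ h1 h2
      have : Real.exp (-((p.b₃ - p.b₁) * (γ t).2)) ≤ 1 :=
        Real.exp_le_one_iff.2 (neg_nonpos.2 (by positivity))
      have h3 := mul_le_mul_of_nonneg_right this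
        (Real.exp_pos (p.a₃ * (γ t).1 + p.b₃ * (γ t).2)).le
      simp only [field]
      linarith
    intro M
    obtain ⟨t₁, ht₁, h⟩ := hinf (|M| + |(γ t₀).1 - 1 * (γ t₀).2|)
    refine ⟨max t₀ t₁, late _ ht₀ _ ht₁, le_max_left _ _, fun t ht htt => ?_⟩
    have htt₀ := (le_max_left _ _).trans htt
    have h3 := h t ht ((le_max_right _ _).trans htt)
    have h4 := hle t ht htt₀
    obtain ⟨h1, h2⟩ := hq t ht htt₀
    rw [Prod.norm_def, Real.norm_of_nonneg h1, Real.norm_of_nonneg h2] at h3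
    have h5 := le_abs_self ((γ t₀).1 - 1 * (γ t₀).2)
    have h6 := le_abs_self M
    have h7 := abs_nonneg ((γ t₀).1 - 1 * (γ t₀).2)
    rcases le_max_iff.1 h3 with h | h <;> linarith
  set d := p.b₂ - p.b₁ with hd
  have hd0 : 0 < d := by linarith [hp.b₁₄, hp.b₄₂]
  -- Chosen so that `u ≤ 2 ε v` forces `(a₁ - a₂) u ≤ (d / 2) v`, leaving `(d / 2) v` to make `e₂`
  -- dominate `e₁`.
  set ε := min 1 (d / (4 * (|p.a₁ - p.a₂| + 1))) with hε
  have hε0 : 0 < ε := by positivity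
  have hε1 : ε ≤ 1 := min_le_left _ _
  have hεd : |p.a₁ - p.a₂| * (2 * ε) ≤ d / 2 := by
    have h1 : ε ≤ d / (4 * (|p.a₁ - p.a₂| + 1)) := min_le_right _ _
    rw [le_div_iff₀ (by positivity)] at h1
    linarith
  -- For such `v`, `e₁ ≤ ε e₃`, so `u - ε v` does not increase either.
  obtain ⟨t₁, ht₁, htt₁, hv₁⟩ := vinf (Real.log (1 / ε) / (p.b₃ - p.b₁))
  have hle₁ := le_of_deriv_nonpos (lin ε) ht₁ fun t ht htt => by
    obtain ⟨h1, h2⟩ := hq t ht (htt₁.trans htt)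
    have h13 := e13 _ h1 h2
    have h42 := e42 _ h1 h2
    have hv := hv₁ t ht htt
    rw [div_le_iff₀' hb13] at hv
    have hexp : Real.exp (-((p.b₃ - p.b₁) * (γ t).2)) ≤ ε := by
      rw [← Real.le_log_iff_exp_le hε0]
      have : Real.log (1 / ε) = -Real.log ε := by rw [one_div, Real.log_inv]
      linarith
    have h3 := mul_le_mul_of_nonneg_right hexp
      (Real.exp_pos (p.a₃ * (γ t).1 + p.b₃ * (γ t).2)).le
    have h4 := mul_le_mul_of_nonneg_right hε1
      (Real.exp_pos (p.a₄ * (γ t).1 + p.b₄ * (γ t).2)).le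
    simp only [field]
    linarith
  -- The first bound absorbs the constant in `u ≤ ε v + const`, giving `u ≤ 2 ε v`; the second
  -- yields `e₁ ≤ e₂ / 2`.
  obtain ⟨t₂, ht₂, htt₂, hv₂⟩ := vinf (max (|(γ t₁).1 - ε * (γ t₁).2| / ε)
    (Real.log 2 / (d / 2)))
  set t₃ := max t₁ t₂ with ht₃
  have ht₃m : t₃ ∈ timeInterval T := late _ ht₁ _ ht₂
  have huv : ∀ t ∈ timeInterval T, t₃ ≤ t → (γ t).1 ≤ 2 * ε * (γ t).2 := by
    intro t ht htt
    have h1 := hle₁ t ht ((le_max_left _ _).trans htt)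
    have h2 := (le_max_left _ _).trans (hv₂ t ht ((le_max_right _ _).trans htt))
    rw [div_le_iff₀' hε0] at h2
    linarith [le_abs_self ((γ t₁).1 - ε * (γ t₁).2)]
  have hf : ∀ t ∈ timeInterval T, t₃ ≤ t → (field p (γ t)).1 ≤
      -(1 / 2) * Real.exp (p.a₂ * (γ t).1 + p.b₂ * (γ t).2) := by
    intro t ht htt
    have h2 := (le_max_right _ _).trans (hv₂ t ht ((le_max_right _ _).trans htt))
    rw [div_le_iff₀' (by positivity)] at h2
    obtain ⟨h3, h4⟩ := hq t ht (htt₂.trans ((le_max_right _ _).trans htt))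
    have hpq : p.a₁ * (γ t).1 + p.b₁ * (γ t).2 ≤
        -Real.log 2 + (p.a₂ * (γ t).1 + p.b₂ * (γ t).2) := by
      have i1 : (p.a₁ - p.a₂) * (γ t).1 ≤ |p.a₁ - p.a₂| * (2 * ε * (γ t).2) :=
        mul_le_mul (le_abs_self _) (huv t ht htt) h3 (abs_nonneg _)
      have i2 := mul_le_mul_of_nonneg_right hεd h4
      have i3 : d * (γ t).2 = p.b₂ * (γ t).2 - p.b₁ * (γ t).2 := by rw [hd]; ring
      linarith
    have := Real.exp_le_exp.2 hpq
    rw [Real.exp_add (-Real.log 2), Real.exp_neg, Real.exp_log two_pos] at this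
    simp only [field]
    linarith
  have hu := le_of_deriv_nonpos du ht₃m fun t ht htt => (hf t ht htt).trans (by
    have := Real.exp_pos (p.a₂ * (γ t).1 + p.b₂ * (γ t).2)
    linarith)
  -- As `u` no longer increases, `e₃ ≤ (κ / 2) e₂`, while `u' ≤ -e₂ / 2`. Thus `κ u + v` does not
  -- increase, which bounds `v`, a contradiction.
  set κ := 2 * Real.exp ((p.a₃ - p.a₂) * (γ t₃).1) with hκ
  have hκ0 : 0 < κ := by positivity
  have hle₃ := le_of_deriv_nonpos (h := fun t => κ * (γ t).1 + (γ t).2)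
    (fun t ht => ((du t ht).const_mul κ).add (dv t ht)) ht₃m fun t ht htt => by
      have h1 := hf t ht htt
      have h2 := hu t ht htt
      obtain ⟨h3, h4⟩ := hq t ht (htt₂.trans ((le_max_right _ _).trans htt))
      have h5 : Real.exp (p.a₃ * (γ t).1 + p.b₃ * (γ t).2) ≤
          κ / 2 * Real.exp (p.a₂ * (γ t).1 + p.b₂ * (γ t).2) := by
        rw [hκ, mul_div_cancel_left₀ _ two_ne_zero, ← Real.exp_add]
        refine Real.exp_le_exp.2 ?_
        have i1 := mul_le_mul_of_nonneg_left h2 (sub_pos.2 hp.a₂₃).le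
        have i2 := mul_le_mul_of_nonneg_right hp.b₃₂ h4
        linarith
      have h6 := mul_le_mul_of_nonneg_left h1 hκ0.le
      have h7 := Real.exp_pos (p.a₄ * (γ t).1 + p.b₄ * (γ t).2)
      have h8 : (field p (γ t)).2 ≤ Real.exp (p.a₃ * (γ t).1 + p.b₃ * (γ t).2) := by
        simp only [field]; linarith
      linarith
  obtain ⟨t₄, ht₄, -, hv₄⟩ := vinf (κ * (γ t₃).1 + (γ t₃).2 + 1)
  have hm := late _ ht₃m _ ht₄
  have h1 := hle₃ _ hm (le_max_left _ _)
  have h2 := hv₄ _ hm (le_max_right _ _)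
  have h3 := (hq _ hm (htt₂.trans ((le_max_right _ _).trans (le_max_left _ _)))).1
  have h4 := mul_nonneg hκ0.le h3
  linarith

/-- At `θ = 0` the point is `(r, 0)`, where `θ'` has the sign of `exp (a₃ r) - exp (a₄ r) > 0`; the
angle cannot descend through `0`. -/
lemma Expanding.angle_nonneg {p : Params} (hp : Expanding p) {T : EReal}
    {γ : ℝ → ℝ × ℝ} {r θ : ℝ → ℝ}
    (hpol : ∀ t ∈ timeInterval T, 0 < r t ∧ γ t = (r t * Real.cos (θ t), r t * Real.sin (θ t)))
    (hθ : ∀ t ∈ timeInterval T, HasDerivWithinAt θ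
      (((γ t).1 * (field p (γ t)).2 - (γ t).2 * (field p (γ t)).1) / ((γ t).1 ^ 2 + (γ t).2 ^ 2))
      (timeInterval T) t)
    {t₀ : ℝ} (ht₀ : t₀ ∈ timeInterval T) (h0 : 0 ≤ θ t₀) :
    ∀ t ∈ timeInterval T, t₀ ≤ t → 0 ≤ θ t := by
  refine le_of_deriv_pos_of_eq hθ ht₀ h0 (fun s hs hs0 => ?_)
  obtain ⟨hr, hpol⟩ := hpol s hs
  rw [hs0, Real.cos_zero, Real.sin_zero, mul_one, mul_zero] at hpol
  have : Real.exp (p.a₄ * r s) < Real.exp (p.a₃ * r s) :=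
    Real.exp_lt_exp.2 (mul_lt_mul_of_pos_right (hp.a₄₂.trans_lt hp.a₂₃) hr)
  rw [hpol]
  simp only [field, mul_zero, add_zero, zero_mul, sub_zero]
  have := sub_pos.2 this
  positivity

/-- The angle along an unbounded orbit of an expanding system eventually exceeds every multiple
of `π / 2`: it cannot decrease through such a multiple, and it cannot stay between two
consecutive ones. -/
lemma Expanding.winding (k : ℕ) : ∀ {p : Params} (_ : Expanding p) {T : EReal}
    {γ : ℝ → ℝ × ℝ} {r θ : ℝ → ℝ}
    (_ : IsIntegralCurveOn γ (fun _ => field p) (timeInterval T))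
    (_ : ∀ M, ∃ t₀ ∈ timeInterval T, ∀ t ∈ timeInterval T, t₀ ≤ t → M ≤ ‖γ t‖)
    (_ : ∀ t ∈ timeInterval T, 0 < r t ∧ γ t = (r t * Real.cos (θ t), r t * Real.sin (θ t)))
    (_ : ∀ t ∈ timeInterval T, HasDerivWithinAt θ
      (((γ t).1 * (field p (γ t)).2 - (γ t).2 * (field p (γ t)).1) / ((γ t).1 ^ 2 + (γ t).2 ^ 2))
      (timeInterval T) t)
    {t₀ : ℝ} (_ : t₀ ∈ timeInterval T) (_ : 0 ≤ θ t₀),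
    ∃ t₁ ∈ timeInterval T, ∀ t ∈ timeInterval T, t₁ ≤ t → k * (Real.pi / 2) ≤ θ t := by
  induction k with
  | zero =>
    intro p hp T γ r θ hγ hinf hpol hθ t₀ ht₀ h0
    refine ⟨t₀, ht₀, fun t ht htt => ?_⟩
    rw [Nat.cast_zero, zero_mul]
    exact hp.angle_nonneg hpol hθ ht₀ h0 t ht htt
  | succ k ih =>
    intro p hp T γ r θ hγ hinf hpol hθ t₀ ht₀ h0
    have hnn := hp.angle_nonneg hpol hθ ht₀ h0
    have hex : ∃ t₁ ∈ timeInterval T, Real.pi / 2 ≤ θ t₁ := by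
      by_contra! hlt
      obtain ⟨t, ht, htt, hn⟩ := hp.exists_not_mem_quadrant hγ hinf ht₀
      obtain ⟨hr, hpol⟩ := hpol t ht
      have h1 := hnn t ht htt
      have h2 := hlt t ht
      refine hn ?_
      rw [hpol]
      exact ⟨mul_nonneg hr.le (Real.cos_nonneg_of_mem_Icc ⟨by linarith [Real.pi_pos], h2.le⟩),
        mul_nonneg hr.le (Real.sin_nonneg_of_mem_Icc ⟨h1, by linarith [Real.pi_pos]⟩)⟩
    obtain ⟨t₁, ht₁, hθ₁⟩ := hex
    -- In the coordinates `(v, -u)` the angle drops by `π / 2` and the system is again expanding, so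
    -- the induction hypothesis applies from `t₁`.
    obtain ⟨t₂, ht₂, h⟩ := ih hp.rot (γ := fun t => ((γ t).2, -(γ t).1)) (r := r)
      (θ := fun t => θ t - Real.pi / 2) (T := T)
      (fun t ht => by
        change HasDerivWithinAt _ (field p.rot ((γ t).2, -(γ t).1)) _ t
        rw [field_rot]
        have h1 : HasDerivWithinAt (fun t => (γ t).1) (field p (γ t)).1 (timeInterval T) t :=
          (hγ t ht).fst
        have h2 : HasDerivWithinAt (fun t => (γ t).2) (field p (γ t)).2 (timeInterval T) t :=
          (hγ t ht).snd
        exact h2.prodMk h1.neg)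
      (fun M => by
        obtain ⟨s, hs, h⟩ := hinf M
        refine ⟨s, hs, fun t ht hst => (h t ht hst).trans_eq ?_⟩
        simp [Prod.norm_def, max_comm])
      (fun t ht => by
        obtain ⟨hr, hpol⟩ := hpol t ht
        refine ⟨hr, ?_⟩
        rw [hpol, Real.cos_sub_pi_div_two, Real.sin_sub_pi_div_two, mul_neg])
      (fun t ht => by
        refine ((hθ t ht).sub_const _).congr_deriv ?_
        rw [field_rot]
        simp only
        ring)
      ht₁ (by simpa using hθ₁)
    refine ⟨t₂, ht₂, fun t ht htt => ?_⟩
    have := h t ht htt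
    push_cast
    linarith

/-! ### Polar coordinates -/

/-- A differentiable curve that avoids the origin has a differentiable angle. -/
lemma exists_polar {T : EReal} (hT : 0 < T) {γ γ' : ℝ → ℝ × ℝ}
    (hγ : ∀ t ∈ timeInterval T, HasDerivWithinAt γ (γ' t) (timeInterval T) t)
    (hγ' : ContinuousOn γ' (timeInterval T)) (h0 : ∀ t ∈ timeInterval T, γ t ≠ 0) :
    ∃ r θ : ℝ → ℝ, 0 ≤ θ 0 ∧
      (∀ t ∈ timeInterval T, 0 < r t ∧ γ t = (r t * Real.cos (θ t), r t * Real.sin (θ t))) ∧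
      ∀ t ∈ timeInterval T, HasDerivWithinAt θ
        (((γ t).1 * (γ' t).2 - (γ t).2 * (γ' t).1) / ((γ t).1 ^ 2 + (γ t).2 ^ 2))
        (timeInterval T) t := by
  have h0T := zero_mem_timeInterval hT
  set e := Complex.equivRealProdCLM.symm with he
  set z : ℝ → ℂ := fun t => e (γ t) with hz
  set z' : ℝ → ℂ := fun t => e (γ' t) with hz'
  have z0 : ∀ t ∈ timeInterval T, z t ≠ 0 := fun t ht h =>
    h0 t ht (e.injective (by rw [map_zero]; exact h))
  have dz : ∀ t ∈ timeInterval T, HasDerivWithinAt z (z' t) (timeInterval T) t := fun t ht =>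
    e.hasFDerivAt.comp_hasDerivWithinAt t (hγ t ht)
  have cz : ContinuousOn z (timeInterval T) := fun t ht => (dz t ht).continuousWithinAt
  have cz' : ContinuousOn z' (timeInterval T) := e.continuous.comp_continuousOn hγ'
  have cq : ContinuousOn (fun t => z' t / z t) (timeInterval T) := cz'.div cz z0
  -- Freezing the quotient for negative times makes it continuous on an open set, so its primitive
  -- has two-sided derivatives also at `0`.
  set q : ℝ → ℂ := fun t => z' (max t 0) / z (max t 0) with hq
  have hq0 : ∀ t ∈ timeInterval T, q t = z' t / z t := fun t ht => by
    simp only [hq, max_eq_left ht.1]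
  set U : Set ℝ := {t | (t : EReal) < T} with hU
  have oU : IsOpen U := isOpen_lt continuous_coe_real_ereal continuous_const
  have hUT : ∀ t ∈ U, max t 0 ∈ timeInterval T := fun t ht => by
    rcases le_total t 0 with h | h
    · rwa [max_eq_right h]
    · rw [max_eq_left h]; exact ⟨h, ht⟩
  have cqU : ContinuousOn q U :=
    cq.comp (f := fun t : ℝ => max t 0) (by fun_prop) hUT
  -- A primitive of `z' / z` is a continuous logarithm of `z`; the extra `2πi` makes the initial
  -- angle nonnegative.
  set ℓ : ℝ → ℂ := fun t => Complex.log (z 0) + 2 * Real.pi * Complex.I + ∫ s in (0 : ℝ)..t, q s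
    with hℓ
  have dℓ : ∀ t ∈ timeInterval T, HasDerivAt ℓ (z' t / z t) t := fun t ht => by
    rw [← hq0 t ht]
    refine HasDerivAt.const_add _ (intervalIntegral.integral_hasDerivAt_right ?_ ?_ ?_)
    · refine (cqU.mono ?_).intervalIntegrable
      rw [uIcc_of_le ht.1]
      exact fun s hs => (Icc_subset_timeInterval ht hs).2
    · exact cqU.stronglyMeasurableAtFilter oU t ht.2
    · exact cqU.continuousAt (oU.mem_nhds ht.2)
  have dw : ∀ t ∈ timeInterval T, HasDerivWithinAt (fun t => z t * Complex.exp (-ℓ t)) 0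
      (timeInterval T) t := fun t ht => by
    refine ((dz t ht).mul (dℓ t ht).neg.cexp.hasDerivWithinAt).congr_deriv ?_
    have := z0 t ht
    field_simp
    ring
  have hexp : ∀ t ∈ timeInterval T, z t = Complex.exp (ℓ t) := by
    intro t ht
    have hsub := Icc_subset_timeInterval ht
    have hc := constant_of_has_deriv_right_zero (a := 0) (b := t)
      (f := fun t => z t * Complex.exp (-ℓ t))
      (fun s hs => (dw s (hsub hs)).continuousWithinAt.mono hsub)
      (fun s hs => (dw s (hsub (Ico_subset_Icc_self hs))).mono_of_mem_nhdsWithin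
        (timeInterval_mem_nhdsGE (hsub (Ico_subset_Icc_self hs)))) t ⟨ht.1, le_rfl⟩
    have hℓ0 : Complex.exp (ℓ 0) = z 0 := by
      simp only [hℓ, intervalIntegral.integral_same, add_zero, Complex.exp_add,
        Complex.exp_two_pi_mul_I, mul_one]
      exact Complex.exp_log (z0 0 h0T)
    simp only [Complex.exp_neg, hℓ0, mul_inv_cancel₀ (z0 0 h0T)] at hc
    exact (mul_inv_eq_one₀ (Complex.exp_ne_zero _)).1 hc
  have zre : ∀ t, (z t).re = (γ t).1 := fun t => by simp [hz, he]
  have zim : ∀ t, (z t).im = (γ t).2 := fun t => by simp [hz, he]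
  have zre' : ∀ t, (z' t).re = (γ' t).1 := fun t => by simp [hz', he]
  have zim' : ∀ t, (z' t).im = (γ' t).2 := fun t => by simp [hz', he]
  refine ⟨fun t => Real.exp (ℓ t).re, fun t => (ℓ t).im, ?_, fun t ht => ⟨Real.exp_pos _, ?_⟩,
    fun t ht => ?_⟩
  · have := Complex.neg_pi_lt_log_im (z 0)
    simp [hℓ]
    linarith [Real.pi_pos, Complex.neg_pi_lt_arg (z 0)]
  · ext
    · rw [← zre, hexp t ht, Complex.exp_re]
    · rw [← zim, hexp t ht, Complex.exp_im]
  · have := Complex.imCLM.hasFDerivAt.comp_hasDerivWithinAt t (dℓ t ht).hasDerivWithinAt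
      (s := timeInterval T)
    refine this.congr_deriv ?_
    rw [Complex.imCLM_apply, Complex.div_im, Complex.normSq_apply, zre, zim, zre', zim', ← sub_div]
    congr 1 <;> ring

/-- Reflection in the diagonal replaces `θ` by `π / 2 - θ` and reverses the sense of winding. -/
lemma SpiralsToInfinity.of_swap {γ : ℝ → ℝ × ℝ} {T : EReal}
    (h : SpiralsToInfinity (fun t => (γ t).swap) T) : SpiralsToInfinity γ T := by
  obtain ⟨r, θ, hc, hp, hr, hθ⟩ := h
  refine ⟨r, fun t => Real.pi / 2 - θ t, continuousOn_const.sub hc, fun t ht => ?_, hr, ?_⟩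
  · obtain ⟨h1, h2⟩ := hp t ht
    refine ⟨h1, ?_⟩
    rw [Real.cos_pi_div_two_sub, Real.sin_pi_div_two_sub, ← Prod.swap_swap (γ t), show (γ t).swap = _ from h2]
    rfl
  · rcases hθ with h | h
    · exact Or.inr (tendsto_atBot_add_const_left _ (Real.pi / 2) (tendsto_neg_atTop_atBot.comp h))
    · exact Or.inl (tendsto_atTop_add_const_left _ (Real.pi / 2) (tendsto_neg_atBot_atTop.comp h))

lemma Expanding.spiralsToInfinity {p : Params} (hp : Expanding p) {T : EReal} (hT : 0 < T)
    {γ : ℝ → ℝ × ℝ} (hγ : IsIntegralCurveOn γ (fun _ => field p) (timeInterval T))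
    (h0 : ∀ t ∈ timeInterval T, γ t ≠ 0)
    (hinf : ∀ M, ∃ t₀ ∈ timeInterval T, ∀ t ∈ timeInterval T, t₀ ≤ t → M ≤ ‖γ t‖) :
    SpiralsToInfinity γ T := by
  obtain ⟨r, θ, hθ0, hpol, hθ⟩ := exists_polar hT hγ
    ((contDiff_field p).continuous.comp_continuousOn hγ.continuousOn) h0
  refine ⟨r, θ, fun t ht => (hθ t ht).continuousWithinAt, hpol, ?_, Or.inl ?_⟩
  · refine tendsto_endOfTime_atTop fun M => ?_
    obtain ⟨t₀, ht₀, h⟩ := hinf M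
    refine ⟨t₀, ht₀, fun t ht htt => (h t ht htt).trans ?_⟩
    obtain ⟨hr, hpt⟩ := hpol t ht
    rw [hpt, Prod.norm_def]
    simp only [norm_mul, Real.norm_eq_abs, abs_of_pos hr]
    exact max_le (mul_le_of_le_one_right hr.le (Real.abs_cos_le_one _))
      (mul_le_of_le_one_right hr.le (Real.abs_sin_le_one _))
  · refine tendsto_endOfTime_atTop fun M => ?_
    obtain ⟨k, hk⟩ := exists_nat_ge (M / (Real.pi / 2))
    obtain ⟨t₁, ht₁, h⟩ := hp.winding k hγ hinf hpol hθ (zero_mem_timeInterval hT) hθ0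
    rw [div_le_iff₀ (by positivity)] at hk
    exact ⟨t₁, ht₁, fun t ht htt => hk.trans (h t ht htt)⟩

lemma largeOrbitsSpiralToInfinity_of_escape {p : Params}
    (h : HasLyapunov (fun x => -field p x))
    (hsp : ∀ x₀ γ T, IsMaximalSolution (field p) x₀ γ T → (∀ t ∈ timeInterval T, γ t ≠ 0) →
      (∀ M, ∃ t₀ ∈ timeInterval T, ∀ t ∈ timeInterval T, t₀ ≤ t → M ≤ ‖γ t‖) →
      SpiralsToInfinity γ T) :
    LargeOrbitsSpiralToInfinity (field p) := by
  obtain ⟨R, -, hesc⟩ := h.escape_of_neg (contDiff_field p)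
  refine ⟨R, fun x₀ hx₀ => ?_⟩
  obtain ⟨γ, T, hγ⟩ := exists_isMaximalSolution (contDiff_field p) x₀
  obtain ⟨h0, hinf⟩ := hesc x₀ hx₀ γ T (Or.inl hγ)
  exact ⟨γ, T, hγ, hsp x₀ γ T hγ h0 hinf⟩

end PlanarSSystem

theorem mainTheorem2 (p : PlanarSSystem.Params)
    (hdet : 0 < (PlanarSSystem.jacobian p).det)
    (L : ℝ)
    (hL : (PlanarSSystem.ConfigA p ∧ L = PlanarSSystem.LinftyA p) ∨
      (PlanarSSystem.ConfigB p ∧ L = PlanarSSystem.LinftyB p)) :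
    (0 < L → PlanarSSystem.Permanent (PlanarSSystem.field p)) ∧
    (L < 0 →
      ¬ PlanarSSystem.Permanent (PlanarSSystem.field p) ∧
      PlanarSSystem.LargeOrbitsSpiralToInfinity (PlanarSSystem.field p)) := by
  open PlanarSSystem in
  have hF := contDiff_field p
  have hrev : field p.rev = fun x => -field p x := funext (field_rev p)
  rcases hL with ⟨hp, rfl⟩ | ⟨hp, rfl⟩
  · refine ⟨fun hL => (hasLyapunov_of_configA hp hL).permanent hF, fun hL => ?_⟩
    have hly : HasLyapunov (fun x => -field p x) :=
      hrev ▸ hasLyapunov_of_configB (rev_configB hp) (by rw [linftyB_rev]; linarith)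
    exact ⟨hly.not_permanent_of_neg hF, largeOrbitsSpiralToInfinity_of_escape hly
      fun x₀ γ T hγ h0 hinf =>
        (expanding_of_configA hp hL).spiralsToInfinity hγ.1.1 hγ.1.2.2 h0 hinf⟩
  · refine ⟨fun hL => (hasLyapunov_of_configB hp hL).permanent hF, fun hL => ?_⟩
    have hly : HasLyapunov (fun x => -field p x) :=
      hrev ▸ hasLyapunov_of_configA (rev_configA hp) (by rw [linftyA_rev]; linarith)
    refine ⟨hly.not_permanent_of_neg hF, largeOrbitsSpiralToInfinity_of_escape hly
      fun x₀ γ T hγ h0 hinf => SpiralsToInfinity.of_swap ?_⟩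
    -- Escape came from time reversal, but winding concerns forward time, so here the reduction to
    -- (A) is the reflection.
    refine (expanding_of_configA (swap_configA hp)
      (by rwa [linftyA_swap])).spiralsToInfinity hγ.1.1 (fun t ht => ?_) (fun t ht h => ?_)
      (fun M => ?_)
    · change HasDerivWithinAt _ (field p.swap (γ t).swap) _ t
      rw [field_swap]
      have h1 : HasDerivWithinAt (fun t => (γ t).1) (field p (γ t)).1 (timeInterval T) t :=
        (hγ.1.2.2 t ht).fst
      have h2 : HasDerivWithinAt (fun t => (γ t).2) (field p (γ t)).2 (timeInterval T) t :=
        (hγ.1.2.2 t ht).snd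
      exact h2.prodMk h1
    · exact h0 t ht (Prod.swap_injective h)
    · obtain ⟨s, hs, h⟩ := hinf M
      refine ⟨s, hs, fun t ht hst => (h t ht hst).trans_eq ?_⟩
      simp [Prod.norm_def, max_comm]
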